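/- Let $\Phi=\{F_1,\dots,F_N\}$ be an iterated function system on $\mathbb R$ consisting of contracting $C^{1+\beta}$-diffeomorphisms $F_i:\mathbb R\to\mathbb R$, where $0<\beta\le 1$: each $F_i$ is a bijection with Lipschitz constant less than $1$ and has a continuous, nowhere vanishing, locally $\beta$-Hölder derivative. Let $E$ be the attractor of $\Phi$ (the non-empty compact set with $E=\bigcup_i F_i(E)$); assume that $E$ is not an interval of positive length and that the convex hulls of $F_i(E)$ and $F_j(E)$ have disjoint interiors whenever $i\ne j$. Let $D$ be the set of bounded connected components of $E^c$ and write $|U|$ for the length of an interval $U$. Let $m\ge 1$ be an integer and $\alpha\in[0,1]$. Let $\delta(t)=t^\alpha$ if $\alpha>0$ and $\delta(t)=1/\max(-\log t,\log 2)$ if $\alpha=0$, and for $U\in D$ put $\delta_U=|U|^m\,\delta(|U|)$. Write $\widehat\mu(\xi)=\int e^{-2\pi i\xi x}\,d\mu(x)$ for the Fourier transform of a measure $\mu$ on $\mathbb R$. Fix a probability measure $\nu$ on $[0,1]$ with $\widehat\nu(\xi)\to 0$ as $|\xi|\to\infty$, and let $P$ be the product measure on $\Omega=\prod_{U\in D}[0,\delta_U]$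 whose $U$-marginal is the image of $\nu$ under $x\mapsto\delta_U x$. Let $\varphi$ be an increasing $C^\infty$-function on $\mathbb R$ that is $0$ on $(-\infty,0]$ and $1$ on $[1,\infty)$, and for $\omega\in\Omega$ define $$f_\omega(x)=x+\sum_{U\in D}\omega_U\,\varphi\!\left(\frac{x-\inf U}{|U|}\right),\qquad x\in\mathbb R .$$ Let $s\ge 0$, let $A$ be a constant and let $\lambda$ be a Borel probability measure on $E$ such that $\lambda(I)\le A|I|^s$ for every bounded interval $I$. Then for $P$-almost every $\omega$, $$\dim_{\mathrm F} f_\omega\lambda\ \ge\ \frac{s}{m+\alpha},$$ where $f_\omega\lambda$ is the image of $\lambda$ under $f_\omega$, and $\dim_{\mathrm F}\mu$ is the supremum of all $t\in[0,1]$ for which $|\widehat\mu(\xi)|\,|\xi|^{t/2}$ is bounded over $\xi\ne 0$. -/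

import Mathlib

open MeasureTheory

namespace RandomImage

noncomputable section

/-! ### Fourier transform and Fourier dimension of a measure on the line -/

/-- The Fourier transform of a measure on `ℝ`, with the normalisation
`∫ exp (-2 π i ξ x) dμ(x)`. -/
def fourierTransform (μ : Measure ℝ) (ξ : ℝ) : ℂ :=
  ∫ x, Complex.exp (-(2 * Real.pi * ξ * x : ℝ) * Complex.I) ∂μ

/-- The Fourier dimension of a probability measure on `ℝ`: the supremum of all `t ∈ [0, 1]` such
that the Fourier transform is bounded by a constant times `|ξ| ^ (-t / 2)`. (The frequency `0`,
where the right hand side is infinite or `1`, is left out because `0 ^ (-t / 2) = 0` in Lean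
for `t > 0`.) -/
def fourierDim (μ : Measure ℝ) : ℝ :=
  sSup {t : ℝ | t ∈ Set.Icc (0 : ℝ) 1 ∧
    ∃ C : ℝ, ∀ ξ : ℝ, ξ ≠ 0 → ‖fourierTransform μ ξ‖ ≤ C * |ξ| ^ (-t / 2)}

/-! ### Iterated function systems -/

/-- `C^{1+β}`-diffeomorphisms of `ℝ` onto `ℝ`: bijections that are continuously differentiable
with nowhere vanishing derivative, the derivative being (locally) Hölder continuous with
exponent `β`. The inverse is then of the same class. -/
structure IsHolderDiffeo (β : NNReal) (F : ℝ → ℝ) : Prop where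
  bijective : Function.Bijective F
  contDiff : ContDiff ℝ 1 F
  deriv_ne_zero : ∀ x, deriv F x ≠ 0
  holder_deriv : ∀ K : Set ℝ, IsCompact K → ∃ C : NNReal, HolderOnWith C β (deriv F) K

/-- `E` is the attractor of the iterated function system `F`. -/
structure IsAttractor {N : ℕ} (F : Fin N → ℝ → ℝ) (E : Set ℝ) : Prop where
  nonempty : E.Nonempty
  isCompact : IsCompact E
  eq_iUnion : E = ⋃ i, F i '' E

/-! ### The random map -/

/-- The set of bounded connected components of the complement of `E`. -/
def holes (E : Set ℝ) : Set (Set ℝ) :=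
  {U | Bornology.IsBounded U ∧ ∃ x ∈ Eᶜ, U = connectedComponentIn Eᶜ x}

/-- The function `δ`. -/
def delta (α t : ℝ) : ℝ :=
  if α = 0 then 1 / max (-Real.log t) (Real.log 2) else t ^ α

/-- `δ_U = |U| ^ m * δ(|U|)`, where `|U|` is the length of the interval `U`. -/
def holeDelta (m : ℕ) (α : ℝ) (U : Set ℝ) : ℝ :=
  Metric.diam U ^ m * delta α (Metric.diam U)

lemma holeDelta_nonneg (m : ℕ) (α : ℝ) (U : Set ℝ) : 0 ≤ holeDelta m α U := by
  have h : (0 : ℝ) ≤ Metric.diam U := Metric.diam_nonneg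
  have h2 : (0 : ℝ) < Real.log 2 := Real.log_pos (by norm_num)
  unfold holeDelta delta
  split_ifs
  · exact mul_nonneg (pow_nonneg h m)
      (one_div_nonneg.mpr (h2.le.trans (le_max_right _ _)))
  · exact mul_nonneg (pow_nonneg h m) (Real.rpow_nonneg h α)

/-- The sample space: the product over the holes `U` of `E` of the intervals `[0, δ_U]`. -/
abbrev Sample (m : ℕ) (α : ℝ) (E : Set ℝ) : Type :=
  (U : holes E) → Set.Icc (0 : ℝ) (holeDelta m α U)

/-- The map `x ↦ δ_U x` from `[0, 1]` to `[0, δ_U]`. -/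
def scale (m : ℕ) (α : ℝ) (U : Set ℝ) (x : Set.Icc (0 : ℝ) 1) :
    Set.Icc (0 : ℝ) (holeDelta m α U) :=
  ⟨holeDelta m α U * x, mul_nonneg (holeDelta_nonneg m α U) x.2.1,
    mul_le_of_le_one_right (holeDelta_nonneg m α U) x.2.2⟩

lemma measurable_scale (m : ℕ) (α : ℝ) (U : Set ℝ) : Measurable (scale m α U) :=
  (measurable_subtype_coe.const_mul _).subtype_mk

/-- The law `ν_U` of the coordinate `ω_U`: the image of `ν` under `x ↦ δ_U x`. -/
def coordLaw (ν : Measure (Set.Icc (0 : ℝ) 1)) (m : ℕ) (α : ℝ) (U : Set ℝ) :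
    Measure (Set.Icc (0 : ℝ) (holeDelta m α U)) :=
  ν.map (scale m α U)

instance (ν : Measure (Set.Icc (0 : ℝ) 1)) [IsProbabilityMeasure ν] (m : ℕ) (α : ℝ)
    (U : Set ℝ) : IsProbabilityMeasure (coordLaw ν m α U) :=
  Measure.isProbabilityMeasure_map (measurable_scale m α U).aemeasurable

/-- The product probability measure `P` on the sample space. -/
def sampleLaw (ν : Measure (Set.Icc (0 : ℝ) 1)) (m : ℕ) (α : ℝ) (E : Set ℝ) :
    Measure (Sample m α E) :=
  Measure.infinitePi fun U : holes E => coordLaw ν m α U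

/-- The functions `φ` used to interpolate across the holes: increasing, smooth, equal to `0` on
`(-∞, 0]` and to `1` on `[1, ∞)`. -/
structure IsStep (φ : ℝ → ℝ) : Prop where
  monotone : Monotone φ
  contDiff : ContDiff ℝ (⊤ : ℕ∞) φ
  eq_zero : ∀ x ≤ 0, φ x = 0
  eq_one : ∀ x, 1 ≤ x → φ x = 1

/-- The random map `f_ω`. For `x ∈ E` the sum is the sum of `ω_U` over those holes `U` that lie
to the left of `x`. -/
def randomMap (φ : ℝ → ℝ) {m : ℕ} {α : ℝ} {E : Set ℝ} (ω : Sample m α E) (x : ℝ) : ℝ :=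
  x + ∑' U : holes E, (ω U : ℝ) * φ ((x - sInf (U : Set ℝ)) / Metric.diam (U : Set ℝ))

end

end RandomImage

/-!
Only the restriction of `f_ω` to `E` matters, where `f_ω x` is `x` plus the sum of the `ω_U` over
the holes `U` to the left of `x`. The Fourier transform `X_ω(ξ)` of the image measure is then an
integral of products of independent random phases, and the proof bounds its moments.

*Geometry.* `E` is porous (`exists_porosity`): two points of `E` at distance `l` are separated by a
hole of length at least `κ l`. This follows from bounded distortion of the compositions
(`exists_distortion`), since images of holes are holes (`isGap_wordMap`); the latter is where
the disjointness of the interiors of the convex hulls enters.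

*Moments.* Fix `ξ`, condition on the holes of length less than `r`, and let `U₁ < ⋯ < Uₙ` be the
others. Up to a factor of modulus one, `X_ω(ξ)` is the last term of a recursion
`V_k = c_k + Z_k V_(k-1)`, where `Z_k = exp (2 π i ξ ω_{U_k})` is independent of `V_(k-1)`, and
`c_k` is the contribution of the points of `E` between two consecutive holes. By porosity these
points lie in an interval of length `O(r)`, so `|c_k| ≤ p` with `p = O(r ^ s)`. If `r` is chosen so
that `δ_U |ξ|` is large for `|U| ≥ r`, the decay of the Fourier transform of `ν` gives
`|E (Z_kᵃ Z̄_kᵇ)| ≤ 1 / 2` for `a ≠ b`.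
The mixed moments `E (V_kᵃ V̄_kᵇ)` with `a ≠ b` are therefore contracted at each step, the errors
made in those with `a = b` add up to a quantity controlled by `∑ |c_k| ≤ 1`, and induction on
`a + b` gives `E |X_ω(ξ)| ^ (2 q) = O(p ^ q)` (`norm_mixedMoment_phaseIntegral_le`,
`exists_moment_le`). Here `r` may be taken as `|ξ| ^ (-1 / (m + α + ε))` up to a constant, where
`ε > 0` absorbs the logarithm in the case `α = 0`.

*Almost sure decay.* For `t < s / (m + α)` and large `q`, the expectations of
`(|X_ω(√n)| n ^ (t / 4)) ^ (2 q)` are summable over `n`, so almost surely these quantities are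
bounded. As `X_ω` is Lipschitz and the frequencies `√n` have spacing at most `1 / √n`, the decay
extends to all frequencies (`exists_decay_of_sqrt`).
-/

open MeasureTheory

namespace RandomImage

open scoped ComplexConjugate

/-! ### Compositions along words and bounded distortion -/

/-- The composition `F i₁ ∘ ⋯ ∘ F iₙ` along the word `[i₁, …, iₙ]`. -/
def wordMap {N : ℕ} (F : Fin N → ℝ → ℝ) : List (Fin N) → ℝ → ℝ
  | [] => id
  | i :: w => F i ∘ wordMap F w

/-- A gap of `E`, given by its two endpoints in either order: distinct points of `E` with no point
of `E` strictly between them. Leaving the order open makes the notion stable under decreasing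
maps. -/
def IsGap (E : Set ℝ) (u v : ℝ) : Prop :=
  u ∈ E ∧ v ∈ E ∧ u ≠ v ∧ ∀ t ∈ Set.uIoo u v, t ∉ E

lemma wordMap_append_singleton {N : ℕ} (F : Fin N → ℝ → ℝ) (w : List (Fin N)) (i : Fin N) (x : ℝ) :
    wordMap F (w ++ [i]) x = wordMap F w (F i x) := by
  induction w with
  | nil => rfl
  | cons j w ih => simp only [List.cons_append, wordMap, Function.comp_apply, ih]

lemma continuous_wordMap {N : ℕ} {F : Fin N → ℝ → ℝ} (hF : ∀ i, Continuous (F i))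
    (w : List (Fin N)) : Continuous (wordMap F w) := by
  induction w with
  | nil => exact continuous_id
  | cons i w ih => exact (hF i).comp ih

lemma injective_wordMap {N : ℕ} {F : Fin N → ℝ → ℝ} (hF : ∀ i, Function.Injective (F i))
    (w : List (Fin N)) : Function.Injective (wordMap F w) := by
  induction w with
  | nil => exact Function.injective_id
  | cons i w ih => exact (hF i).comp ih

lemma mapsTo_wordMap {N : ℕ} {F : Fin N → ℝ → ℝ} {J : Set ℝ} (hF : ∀ i, Set.MapsTo (F i) J J)
    (w : List (Fin N)) : Set.MapsTo (wordMap F w) J J := by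
  induction w with
  | nil => exact Set.mapsTo_id J
  | cons i w ih => exact (hF i).comp ih

lemma abs_wordMap_sub_le {N : ℕ} {F : Fin N → ℝ → ℝ} {c : ℝ} (hc0 : 0 ≤ c)
    (hF : ∀ i x y, |F i x - F i y| ≤ c * |x - y|) (w : List (Fin N)) (x y : ℝ) :
    |wordMap F w x - wordMap F w y| ≤ c ^ w.length * |x - y| := by
  induction w with
  | nil => simp [wordMap]
  | cons i w ih =>
    calc |F i (wordMap F w x) - F i (wordMap F w y)|
        ≤ c * |wordMap F w x - wordMap F w y| := hF i _ _
      _ ≤ c * (c ^ w.length * |x - y|) := by gcongr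
      _ = _ := by rw [List.length_cons, pow_succ]; ring

/-- The mean value theorem for two points in either order, possibly equal. -/
lemma exists_mem_uIcc_sub_eq {f : ℝ → ℝ} (hf : Differentiable ℝ f) (u v : ℝ) :
    ∃ t ∈ Set.uIcc u v, f u - f v = deriv f t * (u - v) := by
  rcases lt_trichotomy u v with h | h | h
  · obtain ⟨t, ht, h'⟩ := exists_deriv_eq_slope f h hf.continuous.continuousOn
      hf.differentiableOn
    refine ⟨t, Set.uIcc_of_le h.le ▸ Set.Ioo_subset_Icc_self ht, ?_⟩
    have : v - u ≠ 0 := (sub_pos.2 h).ne'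
    rw [h']; field_simp; ring
  · exact ⟨u, by simp, by simp [h]⟩
  · obtain ⟨t, ht, h'⟩ := exists_deriv_eq_slope f h hf.continuous.continuousOn
      hf.differentiableOn
    refine ⟨t, Set.uIcc_of_ge h.le ▸ Set.Ioo_subset_Icc_self ht, ?_⟩
    have : u - v ≠ 0 := (sub_pos.2 h).ne'
    rw [h']; field_simp

/-- One-step distortion: two difference quotients of `f` have a ratio close to `1` when they are
taken at nearby places. -/
lemma IsHolderDiffeo.exists_slope_le {β : NNReal} {f : ℝ → ℝ} (hf : IsHolderDiffeo β f)
    {a b : ℝ} (hab : a ≤ b) :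
    ∃ C : ℝ, 0 ≤ C ∧ ∀ u ∈ Set.Icc a b, ∀ v ∈ Set.Icc a b, ∀ x ∈ Set.Icc a b, ∀ y ∈ Set.Icc a b,
      ∃ s ∈ Set.uIcc u v, ∃ t ∈ Set.uIcc x y,
        |f u - f v| * |x - y| ≤ (1 + C * |s - t| ^ (β : ℝ)) * (|f x - f y| * |u - v|) := by
  have hdiff : Differentiable ℝ f := hf.contDiff.differentiable one_ne_zero
  have hcont : Continuous (deriv f) := hf.contDiff.continuous_deriv le_rfl
  obtain ⟨H, hH⟩ := hf.holder_deriv (Set.Icc a b) isCompact_Icc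
  obtain ⟨z, -, hz⟩ := isCompact_Icc.exists_isMinOn (Set.nonempty_Icc.2 hab)
    hcont.abs.continuousOn
  have hm : 0 < |deriv f z| := abs_pos.2 (hf.deriv_ne_zero z)
  refine ⟨H / |deriv f z|, by positivity, fun u hu v hv x hx y hy => ?_⟩
  obtain ⟨s, hs, hs'⟩ := exists_mem_uIcc_sub_eq hdiff u v
  obtain ⟨t, ht, ht'⟩ := exists_mem_uIcc_sub_eq hdiff x y
  refine ⟨s, hs, t, ht, ?_⟩
  have hsJ : s ∈ Set.Icc a b := Set.uIcc_subset_Icc hu hv hs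
  have htJ : t ∈ Set.Icc a b := Set.uIcc_subset_Icc hx hy ht
  have h1 : |deriv f s - deriv f t| ≤ H * |s - t| ^ (β : ℝ) := by
    have := hH.dist_le hsJ htJ
    simpa [Real.dist_eq] using this
  have h2 : |deriv f z| ≤ |deriv f t| := hz htJ
  have h3 : |deriv f s| ≤ (1 + H / |deriv f z| * |s - t| ^ (β : ℝ)) * |deriv f t| := by
    have h4 : |deriv f s| ≤ |deriv f t| + |deriv f s - deriv f t| := by
      linarith [abs_sub_abs_le_abs_sub (deriv f s) (deriv f t)]
    have h5 : (H : ℝ) * |s - t| ^ (β : ℝ)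
        ≤ H / |deriv f z| * |s - t| ^ (β : ℝ) * |deriv f t| := by
      calc (H : ℝ) * |s - t| ^ (β : ℝ)
          = H / |deriv f z| * |s - t| ^ (β : ℝ) * |deriv f z| := by field_simp
        _ ≤ _ := by gcongr
    linarith
  rw [hs', ht', abs_mul, abs_mul]
  calc |deriv f s| * |u - v| * |x - y| = |deriv f s| * (|u - v| * |x - y|) := by ring
    _ ≤ (1 + H / |deriv f z| * |s - t| ^ (β : ℝ)) * |deriv f t| * (|u - v| * |x - y|) := by gcongr
    _ = _ := by ring

/-- Bounded distortion: all difference quotients of a composition along a word are comparable,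
uniformly in the word. Appending an outer letter multiplies the distortion by at most `1 + C rⁿ`
with `r < 1`, and the product of these factors converges. -/
lemma exists_distortion {N : ℕ} {F : Fin N → ℝ → ℝ} {β : NNReal} (hβ : 0 < β)
    (hF : ∀ i, IsHolderDiffeo β (F i)) {c : ℝ} (hc0 : 0 ≤ c) (hc1 : c < 1)
    (hFc : ∀ i x y, |F i x - F i y| ≤ c * |x - y|) {a b : ℝ} (hab : a ≤ b)
    (hJ : ∀ i, Set.MapsTo (F i) (Set.Icc a b) (Set.Icc a b)) :
    ∃ D : ℝ, 0 < D ∧ ∀ w : List (Fin N), ∀ u ∈ Set.Icc a b, ∀ v ∈ Set.Icc a b, ∀ x ∈ Set.Icc a b,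
      ∀ y ∈ Set.Icc a b,
        |wordMap F w u - wordMap F w v| * |x - y|
          ≤ D * (|wordMap F w x - wordMap F w y| * |u - v|) := by
  choose C hC0 hC using fun i => (hF i).exists_slope_le hab
  set K : ℝ := ∑ i, C i
  have hCK : ∀ i, C i ≤ K := fun i =>
    Finset.single_le_sum (f := C) (fun i _ => hC0 i) (Finset.mem_univ i)
  have hK0 : 0 ≤ K := Finset.sum_nonneg fun i _ => hC0 i
  have hβ' : (0 : ℝ) < β := hβ
  set r : ℝ := c ^ (β : ℝ)
  have hr0 : 0 ≤ r := Real.rpow_nonneg hc0 _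
  have hr1 : r < 1 := Real.rpow_lt_one hc0 hc1 hβ'
  set L : ℝ := K * (b - a) ^ (β : ℝ)
  have hL0 : 0 ≤ L := mul_nonneg hK0 (Real.rpow_nonneg (by linarith) _)
  have hcont : ∀ i, Continuous (F i) := fun i => (hF i).contDiff.continuous
  have key : ∀ w : List (Fin N), ∀ u ∈ Set.Icc a b, ∀ v ∈ Set.Icc a b, ∀ x ∈ Set.Icc a b,
      ∀ y ∈ Set.Icc a b,
        |wordMap F w u - wordMap F w v| * |x - y|
          ≤ Real.exp (L * ∑ k ∈ Finset.range w.length, r ^ k)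
            * (|wordMap F w x - wordMap F w y| * |u - v|) := by
    intro w
    induction w with
    | nil => intro u _ v _ x _ y _; simp [wordMap, mul_comm]
    | cons i w ih =>
      intro u hu v hv x hx y hy
      have hw := mapsTo_wordMap hJ w
      obtain ⟨s, hs, t, ht, hst⟩ := hC i _ (hw hu) _ (hw hv) _ (hw hx) _ (hw hy)
      -- the intermediate points lie in the image of `[a, b]`, of length at most `cⁿ (b - a)`
      obtain ⟨s', hs', rfl⟩ :=
        intermediate_value_uIcc (continuous_wordMap hcont w).continuousOn hs
      obtain ⟨t', ht', rfl⟩ :=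
        intermediate_value_uIcc (continuous_wordMap hcont w).continuousOn ht
      have hs'J : s' ∈ Set.Icc a b := Set.uIcc_subset_Icc hu hv hs'
      have ht'J : t' ∈ Set.Icc a b := Set.uIcc_subset_Icc hx hy ht'
      have hd : |wordMap F w s' - wordMap F w t'| ≤ c ^ w.length * (b - a) :=
        (abs_wordMap_sub_le hc0 hFc w s' t').trans (by
          gcongr
          rw [abs_le]; constructor <;> linarith [hs'J.1, hs'J.2, ht'J.1, ht'J.2])
      have hfac : 1 + C i * |wordMap F w s' - wordMap F w t'| ^ (β : ℝ)
          ≤ Real.exp (L * r ^ w.length) := by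
        have h1 : |wordMap F w s' - wordMap F w t'| ^ (β : ℝ)
            ≤ r ^ w.length * (b - a) ^ (β : ℝ) := by
          calc _ ≤ (c ^ w.length * (b - a)) ^ (β : ℝ) := by gcongr
            _ = _ := by
              rw [Real.mul_rpow (by positivity) (by linarith), ← Real.rpow_natCast,
                ← Real.rpow_natCast, ← Real.rpow_mul hc0, ← Real.rpow_mul hc0, mul_comm (β : ℝ)]
        have h2 : C i * |wordMap F w s' - wordMap F w t'| ^ (β : ℝ) ≤ L * r ^ w.length := by
          calc _ ≤ K * (r ^ w.length * (b - a) ^ (β : ℝ)) := by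
                gcongr
                exact hCK i
            _ = _ := by simp only [L]; ring
        linarith [Real.add_one_le_exp (L * r ^ w.length)]
      set U := wordMap F w u
      set V := wordMap F w v
      set X := wordMap F w x
      set Y := wordMap F w y
      have hIH := ih u hu v hv x hx y hy
      rw [List.length_cons, Finset.sum_range_succ, mul_add, Real.exp_add]
      change |F i U - F i V| * |x - y| ≤ _ * (|F i X - F i Y| * |u - v|)
      set e := Real.exp (L * ∑ k ∈ Finset.range w.length, r ^ k)
      set g := Real.exp (L * r ^ w.length)
      rcases eq_or_ne x y with rfl | hxy
      · simp; positivity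
      have hXY : 0 < |X - Y| := by
        rw [abs_pos, sub_ne_zero]
        exact (injective_wordMap (fun i => (hF i).bijective.injective) w).ne hxy
      have h1 : |F i U - F i V| * |X - Y| ≤ g * (|F i X - F i Y| * |U - V|) :=
        hst.trans (by gcongr)
      refine le_of_mul_le_mul_right ?_ hXY
      calc |F i U - F i V| * |x - y| * |X - Y|
          = |F i U - F i V| * |X - Y| * |x - y| := by ring
        _ ≤ g * (|F i X - F i Y| * |U - V|) * |x - y| := by gcongr
        _ = g * |F i X - F i Y| * (|U - V| * |x - y|) := by ring
        _ ≤ g * |F i X - F i Y| * (e * (|X - Y| * |u - v|)) := by gcongr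
        _ = _ := by ring
  refine ⟨Real.exp (L * (1 - r)⁻¹), Real.exp_pos _, fun w u hu v hv x hx y hy =>
    (key w u hu v hv x hx y hy).trans ?_⟩
  gcongr
  exact (Summable.sum_le_tsum _ (fun k _ => pow_nonneg hr0 k)
    (summable_geometric_of_lt_one hr0 hr1)).trans_eq (tsum_geometric_of_lt_one hr0 hr1)

/-- The images of gaps are gaps. -/
lemma isGap_image {N : ℕ} {F : Fin N → ℝ → ℝ} {E : Set ℝ} (hE : IsAttractor F E)
    (hcont : ∀ i, Continuous (F i)) (hinj : ∀ i, Function.Injective (F i))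
    (hdisj : ∀ i j, i ≠ j →
      Disjoint (interior (convexHull ℝ (F i '' E))) (interior (convexHull ℝ (F j '' E))))
    {u v : ℝ} (h : IsGap E u v) (i : Fin N) : IsGap E (F i u) (F i v) := by
  have hsub : ∀ j, F j '' E ⊆ E := fun j => by
    conv_rhs => rw [hE.eq_iUnion]
    exact Set.subset_iUnion (fun j => F j '' E) j
  obtain ⟨hu, hv, huv, hgap⟩ := h
  have hull : ∀ j, Set.uIoo (F j u) (F j v) ⊆ interior (convexHull ℝ (F j '' E)) := fun j => by
    refine interior_maximal ?_ isOpen_Ioo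
    refine Set.Ioo_subset_Icc_self.trans ?_
    have := segment_subset_convexHull (𝕜 := ℝ) (Set.mem_image_of_mem (F j) hu)
      (Set.mem_image_of_mem (F j) hv)
    rwa [segment_eq_uIcc] at this
  refine ⟨hsub i ⟨u, hu, rfl⟩, hsub i ⟨v, hv, rfl⟩, (hinj i).ne huv, fun t ht htE => ?_⟩
  rw [hE.eq_iUnion, Set.mem_iUnion] at htE
  obtain ⟨j, z, hz, rfl⟩ := htE
  rcases eq_or_ne i j with rfl | hij
  · obtain ⟨y, hy, hyz⟩ := intermediate_value_uIcc (hcont i).continuousOn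
      (Set.Ioo_subset_Icc_self ht)
    obtain rfl := hinj i hyz
    have hyu : y ≠ u := by rintro rfl; exact Set.left_notMem_uIoo ht
    have hyv : y ≠ v := by rintro rfl; exact Set.right_notMem_uIoo ht
    refine hgap y ?_ hz
    rcases le_total u v with h | h
    · rw [Set.uIcc_of_le h] at hy
      rw [Set.uIoo_of_le h]
      exact ⟨lt_of_le_of_ne hy.1 hyu.symm, lt_of_le_of_ne hy.2 hyv⟩
    · rw [Set.uIcc_of_ge h] at hy
      rw [Set.uIoo_of_ge h]
      exact ⟨lt_of_le_of_ne hy.1 hyv.symm, lt_of_le_of_ne hy.2 hyu⟩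
  · -- `F j z` lies in the interior of one hull and in the closure of the interior of another
    have hne : (interior (convexHull ℝ (F j '' E))).Nonempty := by
      refine Set.Nonempty.mono (hull j) ?_
      exact Set.nonempty_Ioo.2 (inf_lt_sup.2 ((hinj j).ne huv))
    have hcl : F j z ∈ closure (interior (convexHull ℝ (F j '' E))) := by
      rw [(convex_convexHull ℝ _).closure_interior_eq_closure_of_nonempty_interior hne]
      exact subset_closure (subset_convexHull ℝ _ ⟨z, hz, rfl⟩)
    obtain ⟨y, hy1, hy2⟩ := mem_closure_iff.1 hcl _ isOpen_interior (hull i ht)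
    exact Set.disjoint_left.1 (hdisj i j hij) hy1 hy2

/-! ### Porosity of the attractor -/

lemma isGap_wordMap {N : ℕ} {F : Fin N → ℝ → ℝ} {E : Set ℝ} (hE : IsAttractor F E)
    (hcont : ∀ i, Continuous (F i)) (hinj : ∀ i, Function.Injective (F i))
    (hdisj : ∀ i j, i ≠ j →
      Disjoint (interior (convexHull ℝ (F i '' E))) (interior (convexHull ℝ (F j '' E))))
    {u v : ℝ} (h : IsGap E u v) (w : List (Fin N)) :
    IsGap E (wordMap F w u) (wordMap F w v) := by
  induction w with
  | nil => exact h
  | cons i w ih => exact isGap_image hE hcont hinj hdisj ih i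

lemma IsGap.swap {E : Set ℝ} {u v : ℝ} (h : IsGap E u v) : IsGap E v u :=
  ⟨h.2.1, h.1, h.2.2.1.symm, fun t ht => h.2.2.2 t (by rwa [Set.uIoo_comm])⟩

lemma exists_isGap_of_notMem {E : Set ℝ} (hE : IsCompact E) {x y t : ℝ} (hx : x ∈ E) (hy : y ∈ E)
    (hxt : x ≤ t) (hty : t ≤ y) (ht : t ∉ E) :
    ∃ u v, x ≤ u ∧ u < t ∧ t < v ∧ v ≤ y ∧ IsGap E u v := by
  obtain ⟨u, ⟨huE, hu⟩, humax⟩ := (hE.inter_right isClosed_Icc).exists_isGreatest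
    (⟨x, hx, le_rfl, hxt⟩ : (E ∩ Set.Icc x t).Nonempty)
  obtain ⟨v, ⟨hvE, hv⟩, hvmin⟩ := (hE.inter_right isClosed_Icc).exists_isLeast
    (⟨y, hy, hty, le_rfl⟩ : (E ∩ Set.Icc t y).Nonempty)
  have hut : u < t := lt_of_le_of_ne hu.2 (by rintro rfl; exact ht huE)
  have htv : t < v := lt_of_le_of_ne hv.1 (by rintro rfl; exact ht hvE)
  refine ⟨u, v, hu.1, hut, htv, hv.2, huE, hvE, (hut.trans htv).ne, fun z hz hzE => ?_⟩
  rw [Set.uIoo_of_lt (hut.trans htv)] at hz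
  rcases le_total z t with h | h
  · exact (humax ⟨hzE, hu.1.trans hz.1.le, h⟩).not_gt hz.1
  · exact (hvmin ⟨hzE, h, hz.2.le.trans hv.2⟩).not_gt hz.2

lemma IsAttractor.exists_eq_wordMap {N : ℕ} {F : Fin N → ℝ → ℝ} {E : Set ℝ}
    (hE : IsAttractor F E) {x : ℝ} (hx : x ∈ E) (n : ℕ) :
    ∃ w : List (Fin N), w.length = n ∧ ∃ z ∈ E, x = wordMap F w z := by
  induction n with
  | zero => exact ⟨[], rfl, x, hx, rfl⟩
  | succ n ih =>
    obtain ⟨w, hw, z, hz, rfl⟩ := ih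
    rw [hE.eq_iUnion, Set.mem_iUnion] at hz
    obtain ⟨i, z, hz, rfl⟩ := hz
    exact ⟨w ++ [i], by simp [hw], z, hz, (wordMap_append_singleton F w i z).symm⟩

/-- Porosity of the attractor: any two of its points are separated by a gap of comparable length.
Around a point of `E` well inside `[x, y]` there is a cylinder `F_w [a, b] ⊆ [x, y]` of length
comparable to `y - x`, and by bounded distortion the image under `F_w` of a fixed gap occupies a
definite proportion of that cylinder. -/
lemma exists_porosity {N : ℕ} {F : Fin N → ℝ → ℝ} {β : NNReal} (hβ : 0 < β)
    (hF : ∀ i, IsHolderDiffeo β (F i)) (hFc : ∀ i, ∃ c : NNReal, ContractingWith c (F i))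
    {E : Set ℝ} (hE : IsAttractor F E) (hEI : ¬ ∃ p q : ℝ, p < q ∧ E = Set.Icc p q)
    (hdisj : ∀ i j, i ≠ j →
      Disjoint (interior (convexHull ℝ (F i '' E))) (interior (convexHull ℝ (F j '' E)))) :
    ∃ κ : ℝ, 0 < κ ∧ ∀ x ∈ E, ∀ y ∈ E, x < y →
      ∃ u v, x ≤ u ∧ u < v ∧ v ≤ y ∧ IsGap E u v ∧ κ * (y - x) ≤ v - u := by
  obtain ⟨a, haE, ha⟩ := hE.isCompact.exists_isLeast hE.nonempty
  obtain ⟨b, hbE, hb⟩ := hE.isCompact.exists_isGreatest hE.nonempty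
  rcases (ha hbE).eq_or_lt with hab | hab
  · refine ⟨1, one_pos, fun x hx y hy hxy => ?_⟩
    have h1 := ha hx; have h2 := hb hy
    linarith
  have hcont : ∀ i, Continuous (F i) := fun i => (hF i).contDiff.continuous
  have hinj : ∀ i, Function.Injective (F i) := fun i => (hF i).bijective.injective
  have hEJ : E ⊆ Set.Icc a b := fun x hx => ⟨ha hx, hb hx⟩
  have hsub : ∀ i, ∀ x ∈ E, F i x ∈ E := fun i x hx => by
    rw [hE.eq_iUnion]; exact Set.mem_iUnion.2 ⟨i, x, hx, rfl⟩
  have hJ : ∀ i, Set.MapsTo (F i) (Set.Icc a b) (Set.Icc a b) := fun i x hx => by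
    rcases (hcont i).strictMono_of_inj (hinj i) with h | h
    · exact ⟨(hEJ (hsub i a haE)).1.trans (h.monotone hx.1),
        (h.monotone hx.2).trans (hEJ (hsub i b hbE)).2⟩
    · exact ⟨(hEJ (hsub i b hbE)).1.trans (h.antitone hx.2),
        (h.antitone hx.1).trans (hEJ (hsub i a haE)).2⟩
  have haJ : a ∈ Set.Icc a b := ⟨le_rfl, hab.le⟩
  have hbJ : b ∈ Set.Icc a b := ⟨hab.le, le_rfl⟩
  -- a common contraction ratio
  obtain ⟨c, hc0, hc1, hc⟩ : ∃ c : ℝ, 0 ≤ c ∧ c < 1 ∧ ∀ i x y, |F i x - F i y| ≤ c * |x - y| := by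
    choose k hk using hFc
    refine ⟨(Finset.univ.sup k : NNReal), NNReal.coe_nonneg _, ?_, fun i x y => ?_⟩
    · rw [← NNReal.coe_one, NNReal.coe_lt_coe, Finset.sup_lt_iff one_pos]
      exact fun i _ => (hk i).1
    · have h1 := (hk i).toLipschitzWith.dist_le_mul x y
      rw [Real.dist_eq, Real.dist_eq] at h1
      have h2 : (k i : ℝ) ≤ (Finset.univ.sup k : NNReal) :=
        NNReal.coe_le_coe.2 (Finset.le_sup (Finset.mem_univ i))
      exact h1.trans (by gcongr)
  obtain ⟨D, hD0, hD⟩ := exists_distortion hβ hF hc0 hc1 hc hab.le hJ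
  obtain ⟨t, ht, htE⟩ : ∃ t ∈ Set.Icc a b, t ∉ E := by
    by_contra! h
    exact hEI ⟨a, b, hab, hEJ.antisymm h⟩
  obtain ⟨u₀, v₀, hau₀, hut, htv, hvb₀, hgap₀⟩ :=
    exists_isGap_of_notMem hE.isCompact haE hbE ht.1 ht.2 htE
  have hu₀J : u₀ ∈ Set.Icc a b := hEJ hgap₀.1
  have hv₀J : v₀ ∈ Set.Icc a b := hEJ hgap₀.2.1
  have huv₀ : 0 < v₀ - u₀ := by linarith
  have hba : 0 < b - a := by linarith
  -- `F i a` and `F i b` are at least `l` apart for every `i`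
  obtain ⟨l, hl0, hl⟩ : ∃ l : ℝ, 0 < l ∧ ∀ i, l ≤ |F i a - F i b| := by
    have hpos : ∀ i, 0 < |F i a - F i b| := fun i =>
      abs_pos.2 (sub_ne_zero.2 ((hinj i).ne hab.ne))
    rcases isEmpty_or_nonempty (Fin N) with h | h
    · exact ⟨1, one_pos, fun i => isEmptyElim i⟩
    · obtain ⟨i, hi⟩ := Finite.exists_min fun i => |F i a - F i b|
      exact ⟨_, hpos i, hi⟩
  -- cylinders of prescribed size
  have hcyl : ∀ z ∈ E, ∀ r : ℝ, 0 < r → r < b - a → ∃ w : List (Fin N), ∃ z' ∈ E,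
      z = wordMap F w z' ∧ |wordMap F w a - wordMap F w b| ≤ r ∧
      r * l ≤ D * (b - a) * |wordMap F w a - wordMap F w b| := by
    intro z hz r hr0 hr
    let P : ℕ → Prop := fun n => ∃ w : List (Fin N), w.length = n ∧ ∃ z' ∈ E,
      z = wordMap F w z' ∧ |wordMap F w a - wordMap F w b| ≤ r
    have hP : ∃ n, P n := by
      obtain ⟨n, hn⟩ := exists_pow_lt_of_lt_one (div_pos hr0 hba) hc1
      obtain ⟨w, hw, z', hz', h⟩ := hE.exists_eq_wordMap hz n
      refine ⟨n, w, hw, z', hz', h, (abs_wordMap_sub_le hc0 hc w a b).trans ?_⟩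
      rw [abs_sub_comm, abs_of_pos hba, hw]
      rw [lt_div_iff₀ hba] at hn
      exact hn.le
    classical
    obtain ⟨w, hw, z', hz', h, hwr⟩ := Nat.find_spec hP
    refine ⟨w, z', hz', h, hwr, ?_⟩
    rcases List.eq_nil_or_concat w with rfl | ⟨w', i, rfl⟩
    · change |a - b| ≤ r at hwr
      rw [abs_sub_comm, abs_of_pos hba] at hwr
      linarith
    · rw [List.concat_eq_append] at hw h hwr ⊢
      rw [wordMap_append_singleton] at h
      simp only [wordMap_append_singleton]
      -- the shorter word is too long an interval by minimality
      have hmin : r < |wordMap F w' a - wordMap F w' b| := by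
        by_contra! hle
        refine Nat.find_min hP (m := w'.length) ?_ ⟨w', rfl, F i z', hsub i z' hz', h, hle⟩
        rw [← hw]; simp
      have hd := hD w' a haJ b hbJ _ (hJ i haJ) _ (hJ i hbJ)
      rw [abs_sub_comm a b, abs_of_pos hba] at hd
      calc r * l ≤ |wordMap F w' a - wordMap F w' b| * |F i a - F i b| := by
            gcongr
            exact hl i
        _ ≤ _ := hd
        _ = _ := by ring
  refine ⟨min (1 / 2) (l * (v₀ - u₀) / (4 * (D * (b - a)) * (D * (b - a)))), by positivity,
    fun x hx y hy hxy => ?_⟩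
  have hyx : 0 < y - x := by linarith
  have hxJ := hEJ hx
  have hyJ := hEJ hy
  by_cases hmid : ∃ z ∈ E, x + (y - x) / 4 ≤ z ∧ z ≤ y - (y - x) / 4
  · obtain ⟨z, hz, hz1, hz2⟩ := hmid
    obtain ⟨w, z', hz', h, hw1, hw2⟩ := hcyl z hz ((y - x) / 4) (by linarith)
      (by linarith [hxJ.1, hyJ.2])
    have hmem : ∀ p ∈ Set.Icc a b, wordMap F w p ∈ Set.Icc x y := by
      intro p hp
      have hz'J := hEJ hz'
      have : |wordMap F w p - wordMap F w z'| ≤ |wordMap F w a - wordMap F w b| := by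
        have hu : ∀ q ∈ Set.Icc a b,
            wordMap F w q ∈ Set.uIcc (wordMap F w a) (wordMap F w b) := fun q hq => by
          rcases (continuous_wordMap hcont w).strictMono_of_inj (injective_wordMap hinj w)
            with h | h
          · exact Set.Icc_subset_uIcc ⟨h.monotone hq.1, h.monotone hq.2⟩
          · exact Set.Icc_subset_uIcc' ⟨h.antitone hq.2, h.antitone hq.1⟩
        rw [abs_sub_comm (wordMap F w a)]
        exact Set.abs_sub_le_of_uIcc_subset_uIcc (Set.uIcc_subset_uIcc (hu _ hz'J) (hu _ hp))
      rw [← h] at this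
      have := abs_le.1 (this.trans hw1)
      constructor <;> linarith
    have hgap := isGap_wordMap hE hcont hinj hdisj hgap₀ w
    have hlen : min (1 / 2) (l * (v₀ - u₀) / (4 * (D * (b - a)) * (D * (b - a)))) * (y - x)
        ≤ |wordMap F w u₀ - wordMap F w v₀| := by
      have hd := hD w a haJ b hbJ u₀ hu₀J v₀ hv₀J
      rw [abs_sub_comm a b, abs_of_pos hba, abs_sub_comm u₀, abs_of_pos huv₀] at hd
      refine (mul_le_mul_of_nonneg_right (min_le_right _ _) hyx.le).trans ?_
      have hDb : 0 < D * (b - a) := by positivity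
      rw [div_mul_eq_mul_div, div_le_iff₀ (by positivity)]
      calc l * (v₀ - u₀) * (y - x) = 4 * ((y - x) / 4 * l) * (v₀ - u₀) := by ring
        _ ≤ 4 * (D * (b - a) * |wordMap F w a - wordMap F w b|) * (v₀ - u₀) := by gcongr
        _ = 4 * (D * (b - a)) * (|wordMap F w a - wordMap F w b| * (v₀ - u₀)) := by ring
        _ ≤ 4 * (D * (b - a)) * (D * (|wordMap F w u₀ - wordMap F w v₀| * (b - a))) := by gcongr
        _ = _ := by ring
    rcases lt_or_gt_of_ne hgap.2.2.1 with h' | h'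
    · refine ⟨_, _, (hmem _ hu₀J).1, h', (hmem _ hv₀J).2, hgap, ?_⟩
      rwa [abs_sub_comm, abs_of_pos (sub_pos.2 h')] at hlen
    · refine ⟨_, _, (hmem _ hv₀J).1, h', (hmem _ hu₀J).2, hgap.swap, ?_⟩
      rwa [abs_of_pos (sub_pos.2 h')] at hlen
  · push Not at hmid
    obtain ⟨u, v, h1, h2, h3, h4, hgap⟩ := exists_isGap_of_notMem hE.isCompact hx hy
      (t := (x + y) / 2) (by linarith) (by linarith) fun h => by
        have := hmid _ h (by linarith)
        linarith
    have hu : u < x + (y - x) / 4 := by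
      by_contra! h
      have := hmid u hgap.1 h
      linarith
    have hv : y - (y - x) / 4 < v := by
      have := hmid v hgap.2.1
      by_contra! h
      have := this (by linarith)
      linarith
    refine ⟨u, v, h1, h2.trans h3, h4, hgap, ?_⟩
    have := mul_le_mul_of_nonneg_right (min_le_left (1 / 2)
      (l * (v₀ - u₀) / (4 * (D * (b - a)) * (D * (b - a))))) hyx.le
    linarith

/-! ### Holes and the random map -/

lemma Ioo_mem_holes {E : Set ℝ} {u v : ℝ} (huv : u < v) (h : IsGap E u v) :
    Set.Ioo u v ∈ holes E := by
  obtain ⟨hu, hv, -, hgap⟩ := h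
  rw [Set.uIoo_of_lt huv] at hgap
  obtain ⟨x, hx⟩ := Set.nonempty_Ioo.2 huv
  refine ⟨Metric.isBounded_Ioo u v, x, hgap x hx, ?_⟩
  refine (isPreconnected_Ioo.subset_connectedComponentIn hx hgap).antisymm fun y hy => ?_
  have hord : (connectedComponentIn Eᶜ x).OrdConnected :=
    isPreconnected_connectedComponentIn.ordConnected
  have hxc : x ∈ connectedComponentIn Eᶜ x := mem_connectedComponentIn (hgap x hx)
  constructor
  · by_contra! hyu
    exact connectedComponentIn_subset Eᶜ x (hord.out hy hxc ⟨hyu, hx.1.le⟩) hu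
  · by_contra! hyv
    exact connectedComponentIn_subset Eᶜ x (hord.out hxc hy ⟨hx.2.le, hyv⟩) hv

lemma mem_of_mem_closure_component {E U : Set ℝ} {p x : ℝ} (hx : x ∈ Eᶜ)
    (hU : U = connectedComponentIn Eᶜ x) (hp : p ∈ closure U) (hpU : p ∉ U) : p ∈ E := by
  by_contra hpE
  -- otherwise `U ∪ {p}` is a larger connected subset of the complement
  have h1 : IsPreconnected (insert p U) :=
    (hU ▸ isPreconnected_connectedComponentIn : IsPreconnected U).subset_closure
      (Set.subset_insert p U) (Set.insert_subset hp subset_closure)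
  have hUE : U ⊆ Eᶜ := hU ▸ connectedComponentIn_subset Eᶜ x
  have hxU : x ∈ U := hU ▸ mem_connectedComponentIn hx
  have h2 := h1.subset_connectedComponentIn (Set.mem_insert_of_mem p hxU)
    (Set.insert_subset hpE hUE)
  exact hpU (hU ▸ h2 (Set.mem_insert p U))

/-- A hole of a closed set is an open interval with endpoints in the set. -/
lemma eq_Ioo_of_mem_holes {E U : Set ℝ} (hE : IsClosed E) (hU : U ∈ holes E) :
    sInf U < sSup U ∧ U = Set.Ioo (sInf U) (sSup U) ∧ sInf U ∈ E ∧ sSup U ∈ E := by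
  obtain ⟨hb, x, hx, hUx⟩ := hU
  have hopen : IsOpen U := hUx ▸ hE.isOpen_compl.connectedComponentIn
  have hpre : IsPreconnected U := hUx ▸ isPreconnected_connectedComponentIn
  have hxU : x ∈ U := hUx ▸ mem_connectedComponentIn hx
  have hne : U.Nonempty := ⟨x, hxU⟩
  have hUI : U = Set.Ioo (sInf U) (sSup U) := by
    refine Set.Subset.antisymm ?_
      (IsConnected.Ioo_csInf_csSup_subset ⟨hne, hpre⟩ hb.bddBelow hb.bddAbove)
    rw [← interior_Icc]
    exact hopen.subset_interior_iff.2 (subset_Icc_csInf_csSup hb.bddBelow hb.bddAbove)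
  have hlt : sInf U < sSup U := by
    rw [hUI] at hxU
    exact hxU.1.trans hxU.2
  refine ⟨hlt, hUI, ?_, ?_⟩
  · exact mem_of_mem_closure_component hx hUx (csInf_mem_closure hne hb.bddBelow)
      fun h => by rw [hUI] at h; simp [csInf_Ioo hlt] at h
  · exact mem_of_mem_closure_component hx hUx (csSup_mem_closure hne hb.bddAbove)
      fun h => by rw [hUI] at h; simp [csSup_Ioo hlt] at h

lemma diam_of_mem_holes {E U : Set ℝ} (hE : IsClosed E) (hU : U ∈ holes E) :
    Metric.diam U = sSup U - sInf U := by
  obtain ⟨h1, h2, -, -⟩ := eq_Ioo_of_mem_holes hE hU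
  conv_lhs => rw [h2, Real.diam_Ioo h1.le]

lemma diam_pos_of_mem_holes {E U : Set ℝ} (hE : IsClosed E) (hU : U ∈ holes E) :
    0 < Metric.diam U := by
  rw [diam_of_mem_holes hE hU]
  exact sub_pos.2 (eq_Ioo_of_mem_holes hE hU).1

lemma sSup_le_of_mem_holes {E U : Set ℝ} (hE : IsClosed E) (hU : U ∈ holes E) {x : ℝ}
    (hx : x ∈ E) (h : sInf U < x) : sSup U ≤ x := by
  obtain ⟨-, h2, -, -⟩ := eq_Ioo_of_mem_holes hE hU
  obtain ⟨-, y, -, hy⟩ := hU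
  by_contra! h'
  have h3 : x ∈ U := h2 ▸ ⟨h, h'⟩
  exact connectedComponentIn_subset Eᶜ y (hy ▸ h3) hx

lemma IsStep.eq_ite {φ : ℝ → ℝ} (hφ : IsStep φ) {E U : Set ℝ} (hE : IsClosed E)
    (hU : U ∈ holes E) {x : ℝ} (hx : x ∈ E) :
    φ ((x - sInf U) / Metric.diam U) = if x ≤ sInf U then 0 else 1 := by
  have hd := diam_pos_of_mem_holes hE hU
  split_ifs with h
  · exact hφ.eq_zero _ (div_nonpos_of_nonpos_of_nonneg (by linarith) hd.le)
  · refine hφ.eq_one _ ((one_le_div hd).2 ?_)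
    have := sSup_le_of_mem_holes hE hU hx (not_le.1 h)
    rw [diam_of_mem_holes hE hU]
    linarith

lemma pairwiseDisjoint_holes (E : Set ℝ) : (holes E).PairwiseDisjoint id := by
  rintro U ⟨-, x, hx, rfl⟩ V ⟨-, y, hy, rfl⟩ hne
  refine Set.disjoint_left.2 fun z hz1 hz2 => hne ?_
  exact (connectedComponentIn_eq hz1).trans (connectedComponentIn_eq hz2).symm

lemma isOpen_of_mem_holes {E U : Set ℝ} (hE : IsClosed E) (hU : U ∈ holes E) : IsOpen U := by
  rw [(eq_Ioo_of_mem_holes hE hU).2.1]; exact isOpen_Ioo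

lemma countable_holes {E : Set ℝ} (hE : IsClosed E) : Countable (holes E) :=
  ((pairwiseDisjoint_holes E).countable_of_isOpen (fun _ hU => isOpen_of_mem_holes hE hU)
    fun _ ⟨_, _, hx, h⟩ => h ▸ ⟨_, mem_connectedComponentIn hx⟩).to_subtype

lemma summable_diam_holes {E : Set ℝ} (hE : IsCompact E) :
    Summable fun U : holes E => Metric.diam (U : Set ℝ) := by
  obtain ⟨R, hR⟩ := hE.isBounded.subset_closedBall (0 : ℝ)
  rw [Real.closedBall_eq_Icc] at hR
  have hsub : ∀ U : holes E, (U : Set ℝ) ⊆ Set.Icc (0 - R) (0 + R) := fun U => by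
    obtain ⟨-, h2, h3, h4⟩ := eq_Ioo_of_mem_holes hE.isClosed U.2
    rw [h2]
    exact Set.Ioo_subset_Icc_self.trans (Set.Icc_subset_Icc (hR h3).1 (hR h4).2)
  refine summable_of_sum_le (c := volume.real (Set.Icc (0 - R) (0 + R)))
    (fun _ => Metric.diam_nonneg) fun s => ?_
  have hvol : ∀ U : holes E, Metric.diam (U : Set ℝ) = volume.real (U : Set ℝ) := fun U => by
    obtain ⟨h1, h2, -, -⟩ := eq_Ioo_of_mem_holes hE.isClosed U.2
    rw [diam_of_mem_holes hE.isClosed U.2]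
    conv_rhs => rw [h2, Real.volume_real_Ioo_of_le h1.le]
  simp_rw [hvol]
  have hdisj : Set.PairwiseDisjoint (s : Set (holes E)) fun U : holes E => (U : Set ℝ) :=
    fun U _ V _ hne => pairwiseDisjoint_holes E U.2 V.2 fun h => hne (Subtype.ext h)
  rw [← measureReal_biUnion_finset hdisj
    (fun U _ => (isOpen_of_mem_holes hE.isClosed U.2).measurableSet)
    fun U _ => measure_ne_top_of_subset (hsub U) isCompact_Icc.measure_lt_top.ne]
  exact measureReal_mono (Set.iUnion₂_subset fun U _ => hsub U)
    isCompact_Icc.measure_lt_top.ne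

lemma delta_nonneg {α t : ℝ} (ht : 0 ≤ t) : 0 ≤ delta α t := by
  have h2 : (0 : ℝ) < Real.log 2 := Real.log_pos (by norm_num)
  unfold delta
  split_ifs
  · exact one_div_nonneg.mpr (h2.le.trans (le_max_right _ _))
  · exact Real.rpow_nonneg ht α

lemma delta_mono {α : ℝ} (hα : 0 ≤ α) {r t : ℝ} (hr : 0 < r) (hrt : r ≤ t) :
    delta α r ≤ delta α t := by
  have h2 : (0 : ℝ) < Real.log 2 := Real.log_pos (by norm_num)
  unfold delta
  split_ifs
  · have := Real.log_le_log hr hrt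
    gcongr
  · gcongr

lemma holeDelta_ge {α : ℝ} (hα : 0 ≤ α) (m : ℕ) {U : Set ℝ} {r : ℝ} (hr : 0 < r)
    (h : r ≤ Metric.diam U) : r ^ m * delta α r ≤ holeDelta m α U :=
  mul_le_mul (pow_le_pow_left₀ hr.le h m) (delta_mono hα hr h) (delta_nonneg hr.le)
    (pow_nonneg (hr.le.trans h) m)

lemma delta_le {α : ℝ} (hα : α ∈ Set.Icc (0 : ℝ) 1) {R t : ℝ} (hR : 1 ≤ R) (ht : 0 ≤ t)
    (htR : t ≤ R) : delta α t ≤ max R (1 / Real.log 2) := by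
  have h2 : (0 : ℝ) < Real.log 2 := Real.log_pos (by norm_num)
  unfold delta
  split_ifs
  · refine le_max_of_le_right ?_
    gcongr
    exact le_max_right _ _
  · refine le_max_of_le_left ?_
    calc t ^ α ≤ R ^ α := Real.rpow_le_rpow ht htR hα.1
      _ ≤ R ^ (1 : ℝ) := Real.rpow_le_rpow_of_exponent_le hR hα.2
      _ = R := Real.rpow_one R

lemma summable_holeDelta {E : Set ℝ} (hE : IsCompact E) {m : ℕ} (hm : 1 ≤ m) {α : ℝ}
    (hα : α ∈ Set.Icc (0 : ℝ) 1) : Summable fun U : holes E => holeDelta m α (U : Set ℝ) := by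
  set R : ℝ := max 1 (∑' U : holes E, Metric.diam (U : Set ℝ))
  have hR : 1 ≤ R := le_max_left _ _
  refine Summable.of_nonneg_of_le (fun U => holeDelta_nonneg m α U) (fun U => ?_)
    ((summable_diam_holes hE).mul_left (R ^ (m - 1) * max R (1 / Real.log 2)))
  have h0 : 0 ≤ Metric.diam (U : Set ℝ) := Metric.diam_nonneg
  have h1 : Metric.diam (U : Set ℝ) ≤ R :=
    ((summable_diam_holes hE).le_tsum U fun _ _ => Metric.diam_nonneg).trans (le_max_right _ _)
  obtain ⟨k, rfl⟩ := Nat.exists_eq_add_of_le' hm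
  unfold holeDelta
  calc Metric.diam (U : Set ℝ) ^ (k + 1) * delta α (Metric.diam (U : Set ℝ))
      = Metric.diam (U : Set ℝ) ^ k * delta α (Metric.diam (U : Set ℝ))
        * Metric.diam (U : Set ℝ) := by ring
    _ ≤ _ := by
      rw [Nat.add_sub_cancel]
      have := delta_nonneg (α := α) h0
      have := delta_le hα hR h0 h1
      gcongr

lemma IsStep.nonneg {φ : ℝ → ℝ} (hφ : IsStep φ) (x : ℝ) : 0 ≤ φ x := by
  rcases le_total x 0 with h | h
  · exact (hφ.eq_zero x h).ge
  · exact (hφ.eq_zero 0 le_rfl).ge.trans (hφ.monotone h)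

lemma IsStep.le_one {φ : ℝ → ℝ} (hφ : IsStep φ) (x : ℝ) : φ x ≤ 1 := by
  rcases le_total 1 x with h | h
  · exact (hφ.eq_one x h).le
  · exact (hφ.monotone h).trans (hφ.eq_one 1 le_rfl).le

lemma IsStep.norm_term_le {φ : ℝ → ℝ} (hφ : IsStep φ) {m : ℕ} {α : ℝ} {E : Set ℝ}
    (ω : Sample m α E) (U : holes E) (y : ℝ) : ‖(ω U : ℝ) * φ y‖ ≤ holeDelta m α (U : Set ℝ) := by
  rw [Real.norm_of_nonneg (mul_nonneg (ω U).2.1 (hφ.nonneg y))]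
  exact (mul_le_of_le_one_right (ω U).2.1 (hφ.le_one y)).trans (ω U).2.2

lemma summable_randomMap {φ : ℝ → ℝ} (hφ : IsStep φ) {E : Set ℝ} (hE : IsCompact E) {m : ℕ}
    (hm : 1 ≤ m) {α : ℝ} (hα : α ∈ Set.Icc (0 : ℝ) 1) (ω : Sample m α E) (x : ℝ) :
    Summable fun U : holes E =>
      (ω U : ℝ) * φ ((x - sInf (U : Set ℝ)) / Metric.diam (U : Set ℝ)) :=
  Summable.of_norm_bounded (summable_holeDelta hE hm hα) fun U => hφ.norm_term_le ω U _

lemma continuous_randomMap {φ : ℝ → ℝ} (hφ : IsStep φ) {E : Set ℝ} (hE : IsCompact E) {m : ℕ}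
    (hm : 1 ≤ m) {α : ℝ} (hα : α ∈ Set.Icc (0 : ℝ) 1) :
    Continuous fun p : Sample m α E × ℝ => randomMap φ p.1 p.2 := by
  have hφc := hφ.contDiff.continuous
  refine continuous_snd.add (continuous_tsum (fun U => ?_) (summable_holeDelta hE hm hα)
    fun U p => hφ.norm_term_le p.1 U _)
  exact (continuous_subtype_val.comp ((continuous_apply U).comp continuous_fst)).mul
    (hφc.comp ((continuous_snd.sub continuous_const).div_const _))

lemma measurable_randomMap {φ : ℝ → ℝ} (hφ : IsStep φ) {E : Set ℝ} (hE : IsCompact E) {m : ℕ}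
    (hm : 1 ≤ m) {α : ℝ} (hα : α ∈ Set.Icc (0 : ℝ) 1) :
    Measurable fun p : Sample m α E × ℝ => randomMap φ p.1 p.2 := by
  have := countable_holes hE.isClosed
  exact (continuous_randomMap hφ hE hm hα).measurable

lemma abs_randomMap_le {φ : ℝ → ℝ} (hφ : IsStep φ) {E : Set ℝ} (hE : IsCompact E) {m : ℕ}
    (hm : 1 ≤ m) {α : ℝ} (hα : α ∈ Set.Icc (0 : ℝ) 1) (ω : Sample m α E) (x : ℝ) :
    |randomMap φ ω x| ≤ |x| + ∑' U : holes E, holeDelta m α (U : Set ℝ) :=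
  (abs_add_le _ _).trans (add_le_add le_rfl
    (tsum_of_norm_bounded (summable_holeDelta hE hm hα).hasSum fun U => hφ.norm_term_le ω U _))

/-! ### Resampling and mixed moments -/

lemma measurable_piecewise_prod {ι : Type*} [DecidableEq ι] {X : ι → Type*}
    [∀ i, MeasurableSpace (X i)] (s : Finset ι) :
    Measurable fun p : (∀ i, X i) × (∀ i, X i) => s.piecewise p.1 p.2 := by
  refine measurable_pi_iff.2 fun i => ?_
  by_cases h : i ∈ s
  · simp only [h, Finset.piecewise_eq_of_mem]
    exact (measurable_pi_apply i).comp measurable_fst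
  · simp only [h, not_false_eq_true, Finset.piecewise_eq_of_notMem]
    exact (measurable_pi_apply i).comp measurable_snd

/-- Resampling: taking the coordinates in `s` from one sample and the others from an independent
one gives a sample with the same law. -/
lemma measurePreserving_piecewise {ι : Type*} [DecidableEq ι] {X : ι → Type*}
    [∀ i, MeasurableSpace (X i)] (μ : ∀ i, Measure (X i)) [∀ i, IsProbabilityMeasure (μ i)]
    (s : Finset ι) :
    MeasurePreserving (fun p : (∀ i, X i) × (∀ i, X i) => s.piecewise p.1 p.2)
      ((Measure.infinitePi μ).prod (Measure.infinitePi μ)) (Measure.infinitePi μ) := by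
  refine ⟨measurable_piecewise_prod s, Measure.eq_infinitePi μ fun t T hT => ?_⟩
  rw [Measure.map_apply (measurable_piecewise_prod s)
    (MeasurableSet.pi t.countable_toSet fun i _ => hT i)]
  have h : (fun p : (∀ i, X i) × (∀ i, X i) => s.piecewise p.1 p.2) ⁻¹' (t : Set ι).pi T
      = ((t.filter (· ∈ s) : Finset ι) : Set ι).pi T
        ×ˢ ((t.filter (· ∉ s) : Finset ι) : Set ι).pi T := by
    ext p
    simp only [Set.mem_preimage, Set.mem_pi, Set.mem_prod, Finset.coe_filter, Set.mem_ofPred_eq,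
      Finset.mem_coe]
    constructor
    · refine fun h => ⟨fun i hi => ?_, fun i hi => ?_⟩
      · simpa [hi.2] using h i hi.1
      · simpa [hi.2] using h i hi.1
    · rintro ⟨h1, h2⟩ i hi
      by_cases hs : i ∈ s
      · simpa [hs] using h1 i ⟨hi, hs⟩
      · simpa [hs] using h2 i ⟨hi, hs⟩
  rw [h, Measure.prod_prod, Measure.infinitePi_pi μ fun i _ => hT i,
    Measure.infinitePi_pi μ fun i _ => hT i, Finset.prod_filter_mul_prod_filter_not]

/-- Functions of disjoint sets of coordinates are independent. -/
lemma integral_mul_of_piecewise {ι : Type*} [DecidableEq ι] {X : ι → Type*}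
    [∀ i, MeasurableSpace (X i)] (μ : ∀ i, Measure (X i)) [∀ i, IsProbabilityMeasure (μ i)]
    (s : Finset ι) {f g : (∀ i, X i) → ℂ} (hf : Measurable f) (hg : Measurable g)
    (hfs : ∀ ω ω', f (s.piecewise ω ω') = f ω) (hgs : ∀ ω ω', g (s.piecewise ω ω') = g ω') :
    ∫ ω, f ω * g ω ∂Measure.infinitePi μ
      = (∫ ω, f ω ∂Measure.infinitePi μ) * ∫ ω, g ω ∂Measure.infinitePi μ := by
  have hmp := measurePreserving_piecewise μ s
  calc ∫ ω, f ω * g ω ∂Measure.infinitePi μ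
      = ∫ ω, f ω * g ω ∂((Measure.infinitePi μ).prod (Measure.infinitePi μ)).map
          fun p : (∀ i, X i) × (∀ i, X i) => s.piecewise p.1 p.2 := by rw [hmp.map_eq]
    _ = ∫ p, f (s.piecewise p.1 p.2) * g (s.piecewise p.1 p.2)
          ∂(Measure.infinitePi μ).prod (Measure.infinitePi μ) :=
        integral_map hmp.measurable.aemeasurable (hf.mul hg).aestronglyMeasurable
    _ = _ := by
      simp only [hfs, hgs]
      exact integral_prod_mul f g

/-- The mixed moment `E (Yᵃ Ȳᵇ)` of a complex random variable `Y`. -/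
noncomputable def mixedMoment {Ω : Type*} [MeasurableSpace Ω] (P : Measure Ω) (Y : Ω → ℂ)
    (a b : ℕ) : ℂ :=
  ∫ ω, Y ω ^ a * conj (Y ω) ^ b ∂P

lemma norm_pow_mul_conj_pow_le {y : ℂ} (hy : ‖y‖ ≤ 1) (a b : ℕ) : ‖y ^ a * conj y ^ b‖ ≤ 1 := by
  rw [norm_mul, norm_pow, norm_pow, RCLike.norm_conj]
  exact mul_le_one₀ (pow_le_one₀ (norm_nonneg _) hy) (by positivity)
    (pow_le_one₀ (norm_nonneg _) hy)

lemma measurable_pow_mul_conj_pow {Ω : Type*} [MeasurableSpace Ω] {Y : Ω → ℂ} (hY : Measurable Y)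
    (a b : ℕ) : Measurable fun ω => Y ω ^ a * conj (Y ω) ^ b :=
  (hY.pow_const a).mul ((Complex.continuous_conj.measurable.comp hY).pow_const b)

/-- The moments of `c + Z W`, for `Z` and `W` independent: expanding the powers, all terms but the
leading one have a factor `c`. -/
lemma norm_mixedMoment_add_mul_le {Ω : Type*} [MeasurableSpace Ω] (P : Measure Ω)
    [IsProbabilityMeasure P] {Z W : Ω → ℂ} (hZ : Measurable Z) (hW : Measurable W)
    (hZ1 : ∀ ω, ‖Z ω‖ ≤ 1) (hW1 : ∀ ω, ‖W ω‖ ≤ 1)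
    (hZW : ∀ i j, ∫ ω, (Z ω ^ i * conj (Z ω) ^ j) * (W ω ^ i * conj (W ω) ^ j) ∂P
      = mixedMoment P Z i j * mixedMoment P W i j) (c : ℂ) (a b : ℕ) {M : ℝ}
    (hM0 : 0 ≤ M)
    (hM : ∀ i ≤ a, ∀ j ≤ b, i + j < a + b →
      ‖c‖ ^ (a + b - (i + j)) * ‖mixedMoment P W i j‖ ≤ M) :
    ‖mixedMoment P (fun ω => c + Z ω * W ω) a b‖
      ≤ ‖mixedMoment P Z a b‖ * ‖mixedMoment P W a b‖ + 2 ^ (a + b) * M := by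
  have hZm : ∀ i j, ‖mixedMoment P Z i j‖ ≤ 1 := fun i j => by
    refine (norm_integral_le_of_norm_le_const (C := 1)
      (ae_of_all _ fun ω => norm_pow_mul_conj_pow_le (hZ1 ω) i j)).trans ?_
    simp
  let T : ℕ × ℕ → ℂ := fun q => (a.choose q.1 * b.choose q.2 : ℂ)
    * (c ^ (a - q.1) * conj c ^ (b - q.2)) * (mixedMoment P Z q.1 q.2 * mixedMoment P W q.1 q.2)
  set I := Finset.range (a + 1) ×ˢ Finset.range (b + 1) with hI
  have hexp : mixedMoment P (fun ω => c + Z ω * W ω) a b = ∑ q ∈ I, T q := by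
    have h1 : ∀ ω, (c + Z ω * W ω) ^ a * conj (c + Z ω * W ω) ^ b
        = ∑ q ∈ I, (a.choose q.1 * b.choose q.2 : ℂ) * (c ^ (a - q.1) * conj c ^ (b - q.2))
          * ((Z ω ^ q.1 * conj (Z ω) ^ q.2) * (W ω ^ q.1 * conj (W ω) ^ q.2)) := fun ω => by
      rw [map_add, map_mul, add_comm c, add_comm (conj c), add_pow, add_pow,
        Finset.sum_mul_sum, ← Finset.sum_product']
      refine Finset.sum_congr rfl fun q _ => ?_
      rw [mul_pow, mul_pow]
      ring
    simp only [mixedMoment, h1]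
    rw [integral_finsetSum]
    · refine Finset.sum_congr rfl fun q _ => ?_
      rw [integral_const_mul, hZW]
    · intro q _
      refine Integrable.const_mul (Integrable.of_bound (C := 1) ?_ (ae_of_all _ fun ω => ?_)) _
      · exact ((measurable_pow_mul_conj_pow hZ _ _).mul
          (measurable_pow_mul_conj_pow hW _ _)).aestronglyMeasurable
      · rw [norm_mul]
        exact mul_le_one₀ (norm_pow_mul_conj_pow_le (hZ1 ω) _ _) (norm_nonneg _)
          (norm_pow_mul_conj_pow_le (hW1 ω) _ _)
  have hab : (a, b) ∈ I := by simp [hI]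
  rw [hexp, ← Finset.add_sum_erase I T hab]
  refine (norm_add_le _ _).trans (add_le_add ?_ ?_)
  · simp [T]
  · have hterm : ∀ q ∈ I.erase (a, b), ‖T q‖ ≤ (a.choose q.1 * b.choose q.2 : ℝ) * M := by
      rintro ⟨i, j⟩ hq
      obtain ⟨hne, hq⟩ := Finset.mem_erase.1 hq
      simp only [hI, Finset.mem_product, Finset.mem_range] at hq
      have hlt : i + j < a + b := by
        rcases lt_or_eq_of_le (show i + j ≤ a + b by omega) with h | h
        · exact h
        · exact absurd (Prod.ext (by simp; omega) (by simp; omega)) hne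
      have hc : ‖c ^ (a - i) * conj c ^ (b - j)‖ = ‖c‖ ^ (a + b - (i + j)) := by
        rw [norm_mul, norm_pow, norm_pow, RCLike.norm_conj, ← pow_add]
        congr 1; omega
      simp only [T]
      rw [norm_mul, norm_mul, hc, norm_mul, norm_mul, Complex.norm_natCast, Complex.norm_natCast,
        mul_assoc]
      gcongr
      calc ‖c‖ ^ (a + b - (i + j)) * (‖mixedMoment P Z i j‖ * ‖mixedMoment P W i j‖)
          ≤ ‖c‖ ^ (a + b - (i + j)) * (1 * ‖mixedMoment P W i j‖) := by
            gcongr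
            exact hZm i j
        _ ≤ M := by
          rw [one_mul]
          exact hM i (by omega) j (by omega) hlt
    refine (norm_sum_le _ _).trans ((Finset.sum_le_sum hterm).trans ?_)
    refine (Finset.sum_le_sum_of_subset_of_nonneg (Finset.erase_subset _ _)
      fun q _ _ => by positivity).trans_eq ?_
    rw [← Finset.sum_mul, hI, Finset.sum_product]
    dsimp only
    rw [← Finset.sum_mul_sum]
    have h2 : ∀ n : ℕ, ∑ i ∈ Finset.range (n + 1), (n.choose i : ℝ) = 2 ^ n := fun n => by
      exact_mod_cast Nat.sum_range_choose n
    rw [h2, h2, pow_add]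

/-! ### Moments of integrals of random phases -/

/-- The integral over `B` of a deterministic phase `g` times the random phases `z i (ω i)`, for
`i ∈ S`, of which the point `x` receives those with `x ≤ u i`. -/
noncomputable def phaseIntegral {ι : Type*} {X : ι → Type*} (lam : Measure ℝ) (u : ι → ℝ)
    (z : ∀ i, X i → ℂ) (g : ℝ → ℂ) (S : Finset ι) (B : Set ℝ) (ω : ∀ i, X i) : ℂ :=
  ∫ x in B, g x * ∏ i ∈ S, (if x ≤ u i then z i (ω i) else 1) ∂lam

section

variable {ι : Type*} {X : ι → Type*} {lam : Measure ℝ} {u : ι → ℝ} {z : ∀ i, X i → ℂ} {g : ℝ → ℂ}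

lemma norm_phase_le (hz : ∀ i t, ‖z i t‖ ≤ 1) (hg : ∀ x, ‖g x‖ ≤ 1) (S : Finset ι)
    (ω : ∀ i, X i) (x : ℝ) : ‖g x * ∏ i ∈ S, (if x ≤ u i then z i (ω i) else 1)‖ ≤ 1 := by
  rw [norm_mul, norm_prod]
  refine mul_le_one₀ (hg x) (by positivity) (Finset.prod_le_one (fun _ _ => norm_nonneg _) ?_)
  intro i _
  split_ifs
  · exact hz i _
  · simp

lemma norm_phaseIntegral_le [IsFiniteMeasure lam] (hz : ∀ i t, ‖z i t‖ ≤ 1) (hg : ∀ x, ‖g x‖ ≤ 1)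
    (S : Finset ι) (B : Set ℝ) (ω : ∀ i, X i) :
    ‖phaseIntegral lam u z g S B ω‖ ≤ lam.real B := by
  refine (norm_setIntegral_le_of_norm_le_const (C := 1) (measure_lt_top lam B)
    fun x _ => norm_phase_le hz hg S ω x).trans ?_
  rw [one_mul]

lemma measurable_phase (hgm : Measurable g) (S : Finset ι) (ω : ∀ i, X i) :
    Measurable fun x => g x * ∏ i ∈ S, (if x ≤ u i then z i (ω i) else 1) :=
  hgm.mul (Finset.measurable_fun_prod _ fun _ _ =>
    Measurable.ite measurableSet_Iic measurable_const measurable_const)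

/-- Splitting off the rightmost index: to its right no random phase is left, and to its left its
own phase factors out. -/
lemma phaseIntegral_insert [DecidableEq ι] [IsFiniteMeasure lam] (hz : ∀ i t, ‖z i t‖ ≤ 1)
    (hg : ∀ x, ‖g x‖ ≤ 1) (hgm : Measurable g) {S : Finset ι} {k : ι} (hk : k ∉ S)
    (hmax : ∀ i ∈ S, u i ≤ u k) {B : Set ℝ} (hB : MeasurableSet B) (ω : ∀ i, X i) :
    phaseIntegral lam u z g (insert k S) B ω
      = (∫ x in B ∩ Set.Ioi (u k), g x ∂lam)
        + z k (ω k) * phaseIntegral lam u z g S (B ∩ Set.Iic (u k)) ω := by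
  have hint : ∀ T : Set ℝ, IntegrableOn
      (fun x => g x * ∏ i ∈ insert k S, (if x ≤ u i then z i (ω i) else 1)) T lam := fun T =>
    Integrable.of_bound (measurable_phase hgm _ ω).aestronglyMeasurable 1
      (ae_of_all _ fun x => norm_phase_le hz hg _ ω x)
  unfold phaseIntegral
  rw [← integral_inter_add_sdiff (t := Set.Ioi (u k)) measurableSet_Ioi (hint B), ← Set.compl_Ioi,
    ← Set.sdiff_eq, ← integral_const_mul]
  congr 1
  · refine setIntegral_congr_fun (hB.inter measurableSet_Ioi) fun x hx => ?_
    rw [Finset.prod_eq_one, mul_one]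
    intro i hi
    have : u i < x := by
      rcases Finset.mem_insert.1 hi with rfl | hi
      · exact hx.2
      · exact (hmax i hi).trans_lt hx.2
    rw [if_neg this.not_ge]
  · refine setIntegral_congr_fun (hB.diff measurableSet_Ioi) fun x hx => ?_
    rw [Finset.prod_insert hk, if_pos (not_lt.1 hx.2)]
    ring

lemma phaseIntegral_congr (lam : Measure ℝ) (u : ι → ℝ) (z : ∀ i, X i → ℂ) (g : ℝ → ℂ)
    {S : Finset ι} (B : Set ℝ) {ω ω' : ∀ i, X i} (h : ∀ i ∈ S, ω i = ω' i) :
    phaseIntegral lam u z g S B ω = phaseIntegral lam u z g S B ω' := by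
  unfold phaseIntegral
  congr 1
  ext x
  rw [Finset.prod_congr rfl fun i hi => by rw [h i hi]]

lemma measurable_phaseIntegral [∀ i, MeasurableSpace (X i)] [IsFiniteMeasure lam]
    (hzm : ∀ i, Measurable (z i)) (hgm : Measurable g) (S : Finset ι) (B : Set ℝ) :
    Measurable (phaseIntegral lam u z g S B) := by
  have : Measurable fun p : (∀ i, X i) × ℝ =>
      g p.2 * ∏ i ∈ S, (if p.2 ≤ u i then z i (p.1 i) else 1) :=
    (hgm.comp measurable_snd).mul (Finset.measurable_fun_prod _ fun i _ =>
      Measurable.ite (measurableSet_Iic.preimage measurable_snd)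
        ((hzm i).comp ((measurable_pi_apply i).comp measurable_fst)) measurable_const)
  exact (this.stronglyMeasurable.integral_prod_right (ν := lam.restrict B)).measurable

lemma mixedMoment_eval [∀ i, MeasurableSpace (X i)] (μ : ∀ i, Measure (X i))
    [∀ i, IsProbabilityMeasure (μ i)] {k : ι} (hzm : Measurable (z k)) (a b : ℕ) :
    mixedMoment (Measure.infinitePi μ) (fun ω => z k (ω k)) a b = mixedMoment (μ k) (z k) a b := by
  have := (measurePreserving_eval_infinitePi μ k)
  unfold mixedMoment
  rw [← this.map_eq, integral_map this.measurable.aemeasurable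
    (measurable_pow_mul_conj_pow hzm a b).aestronglyMeasurable]

/-- Moments of a sum of random phases. When the phases have mixed moments at most `1 / 2` off the
diagonal, and every block of points sharing all their random phases has mass at most `p`, the
`2 q`-th absolute moment is `O (p ^ q)`. The rightmost phase is split off in `V = c + Z W`; in the
resulting recursion the off-diagonal moments are contracted by `1 / 2` while the diagonal ones
accumulate errors proportional to the mass of the block that is split off. -/
theorem norm_mixedMoment_phaseIntegral_le [∀ i, MeasurableSpace (X i)] (μ : ∀ i, Measure (X i))
    [∀ i, IsProbabilityMeasure (μ i)] [IsProbabilityMeasure lam] (hz : ∀ i t, ‖z i t‖ ≤ 1)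
    (hzm : ∀ i, Measurable (z i)) (hg : ∀ x, ‖g x‖ ≤ 1) (hgm : Measurable g) {p : ℝ} (hp0 : 0 ≤ p)
    (hp1 : p ≤ 1) {n : ℕ} (d : ℕ) (hd : d ≤ n) (S : Finset ι)
    (hS : ∀ i ∈ S, ∀ a b, a ≠ b → a + b ≤ n → ‖mixedMoment (μ i) (z i) a b‖ ≤ 1 / 2) (B : Set ℝ)
    (hB : MeasurableSet B)
    (hblock : ∀ T ⊆ B, MeasurableSet T → (∀ x ∈ T, ∀ y ∈ T, ∀ i ∈ S, x ≤ u i ↔ y ≤ u i) →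
      lam.real T ≤ p) (a b : ℕ) (hab : a + b = d) :
    ‖mixedMoment (Measure.infinitePi μ) (phaseIntegral lam u z g S B) a b‖
      ≤ 4 ^ (d ^ 2) * p ^ ((d + 1) / 2) := by
  classical
  induction d using Nat.strong_induction_on generalizing S B a b with
  | _ d ih =>
  have hV1 : ∀ S B ω, ‖phaseIntegral lam u z g S B ω‖ ≤ 1 := fun S B ω =>
    (norm_phaseIntegral_le hz hg S B ω).trans measureReal_le_one
  rcases Nat.eq_zero_or_pos d with rfl | hd0
  · obtain ⟨rfl, rfl⟩ : a = 0 ∧ b = 0 := by omega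
    simp [mixedMoment]
  set R : ℝ := 2 ^ d * 4 ^ ((d - 1) ^ 2) with hR
  have hR1 : 1 ≤ R := one_le_mul_of_one_le_of_one_le (one_le_pow₀ (by norm_num))
    (one_le_pow₀ (by norm_num))
  have hR4 : 2 * R ≤ 4 ^ (d ^ 2) := by
    obtain ⟨e, rfl⟩ := Nat.exists_eq_add_of_le' hd0
    rw [hR, Nat.add_sub_cancel, show (4 : ℝ) = 2 ^ 2 by norm_num, ← pow_mul, ← pow_mul, ← pow_add,
      ← pow_succ']
    refine pow_le_pow_right₀ (by norm_num) ?_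
    nlinarith
  suffices h : ‖mixedMoment (Measure.infinitePi μ) (phaseIntegral lam u z g S B) a b‖
      ≤ (if a = b then lam.real B else 2) * (R * p ^ ((d + 1) / 2)) by
    refine h.trans ?_
    have h2 : (if a = b then lam.real B else 2) ≤ 2 := by
      split_ifs
      · exact measureReal_le_one.trans (by norm_num)
      · exact le_rfl
    calc _ ≤ 2 * (R * p ^ ((d + 1) / 2)) := by gcongr
      _ = 2 * R * p ^ ((d + 1) / 2) := by ring
      _ ≤ _ := by gcongr
  induction S using Finset.induction_on_max_value u generalizing B with
  | empty =>
    have hBp : lam.real B ≤ p := hblock B subset_rfl hB fun _ _ _ _ i hi => by simp at hi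
    have h1 : ‖mixedMoment (Measure.infinitePi μ) (phaseIntegral lam u z g ∅ B) a b‖
        ≤ lam.real B ^ d := by
      refine (norm_integral_le_of_norm_le_const (C := lam.real B ^ d)
        (ae_of_all _ fun ω => ?_)).trans (by simp)
      rw [norm_mul, norm_pow, norm_pow, RCLike.norm_conj, ← pow_add, hab]
      gcongr
      exact norm_phaseIntegral_le hz hg ∅ B ω
    refine h1.trans ?_
    have hB0 : 0 ≤ lam.real B := measureReal_nonneg
    split_ifs with heq
    · calc lam.real B ^ d = lam.real B * lam.real B ^ (d - 1) := by
            rw [← pow_succ', Nat.sub_add_cancel hd0]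
        _ ≤ lam.real B * p ^ (d - 1) := by gcongr
        _ ≤ lam.real B * p ^ ((d + 1) / 2) := by
          gcongr ?_ * ?_
          exact pow_le_pow_of_le_one hp0 hp1 (by omega)
        _ ≤ _ := by
          gcongr
          exact le_mul_of_one_le_left (by positivity) hR1
    · calc lam.real B ^ d ≤ p ^ d := by gcongr
        _ ≤ p ^ ((d + 1) / 2) := pow_le_pow_of_le_one hp0 hp1 (by omega)
        _ ≤ R * p ^ ((d + 1) / 2) := le_mul_of_one_le_left (by positivity) hR1
        _ ≤ _ := by linarith [show 0 ≤ R * p ^ ((d + 1) / 2) by positivity]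
  | insert k S hk hmax ihS =>
    set B₁ := B ∩ Set.Ioi (u k)
    set B₂ := B ∩ Set.Iic (u k)
    have hB₂ : MeasurableSet B₂ := hB.inter measurableSet_Iic
    have hB₁p : lam.real B₁ ≤ p := by
      refine hblock B₁ Set.inter_subset_left (hB.inter measurableSet_Ioi) fun x hx y hy i hi => ?_
      have : u i ≤ u k := by
        rcases Finset.mem_insert.1 hi with rfl | hi
        · exact le_rfl
        · exact hmax i hi
      exact iff_of_false (this.trans_lt hx.2).not_ge (this.trans_lt hy.2).not_ge
    have hS' : ∀ i ∈ S, ∀ a b, a ≠ b → a + b ≤ n → ‖mixedMoment (μ i) (z i) a b‖ ≤ 1 / 2 :=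
      fun i hi => hS i (Finset.mem_insert_of_mem hi)
    have hblock' : ∀ T ⊆ B₂, MeasurableSet T →
        (∀ x ∈ T, ∀ y ∈ T, ∀ i ∈ S, x ≤ u i ↔ y ≤ u i) → lam.real T ≤ p := by
      refine fun T hT hTm h => hblock T (hT.trans Set.inter_subset_left) hTm
        fun x hx y hy i hi => ?_
      rcases Finset.mem_insert.1 hi with rfl | hi
      · exact iff_of_true (hT hx).2 (hT hy).2
      · exact h x hx y hy i hi
    set c : ℂ := ∫ x in B₁, g x ∂lam
    have hc : ‖c‖ ≤ lam.real B₁ := by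
      refine (norm_setIntegral_le_of_norm_le_const (C := 1) (measure_lt_top lam B₁)
        fun x _ => hg x).trans ?_
      rw [one_mul]
    set W := phaseIntegral lam u z g S B₂
    have hWm : Measurable W := measurable_phaseIntegral hzm hgm S B₂
    have hZm : Measurable fun ω : ∀ i, X i => z k (ω k) := (hzm k).comp (measurable_pi_apply k)
    have hind : ∀ i j, ∫ ω, (z k (ω k) ^ i * conj (z k (ω k)) ^ j) * (W ω ^ i * conj (W ω) ^ j)
          ∂Measure.infinitePi μ
        = mixedMoment (Measure.infinitePi μ) (fun ω => z k (ω k)) i j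
          * mixedMoment (Measure.infinitePi μ) W i j := fun i j => by
      refine integral_mul_of_piecewise μ {k} (measurable_pow_mul_conj_pow hZm i j)
        (measurable_pow_mul_conj_pow hWm i j) (fun ω ω' => by simp) fun ω ω' => ?_
      have : W (({k} : Finset ι).piecewise ω ω') = W ω' :=
        phaseIntegral_congr lam u z g B₂ fun i hi =>
          Finset.piecewise_eq_of_notMem _ _ _ (by
            rw [Finset.mem_singleton]; rintro rfl; exact hk hi)
      rw [this]
    have hstep := norm_mixedMoment_add_mul_le (Measure.infinitePi μ) hZm hWm
      (fun ω => hz k (ω k)) (hV1 S B₂) hind c a b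
      (M := lam.real B₁ * (4 ^ ((d - 1) ^ 2) * p ^ (d / 2))) (by positivity) (by
        intro i _ j _ hij
        rw [hab] at hij ⊢
        have h1 := ih (i + j) hij (by omega) S hS' B₂ hB₂ hblock' i j rfl
        obtain ⟨e, he⟩ : ∃ e, d - (i + j) = e + 1 := ⟨d - (i + j) - 1, by omega⟩
        rw [he]
        calc ‖c‖ ^ (e + 1) * ‖mixedMoment (Measure.infinitePi μ) W i j‖
            ≤ lam.real B₁ ^ (e + 1) * (4 ^ ((i + j) ^ 2) * p ^ ((i + j + 1) / 2)) := by gcongr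
          _ = lam.real B₁ * (4 ^ ((i + j) ^ 2) * (lam.real B₁ ^ e * p ^ ((i + j + 1) / 2))) := by
            ring
          _ ≤ lam.real B₁ * (4 ^ ((d - 1) ^ 2) * (p ^ e * p ^ ((i + j + 1) / 2))) := by
            gcongr
            · norm_num
            · omega
          _ ≤ _ := by
            rw [← pow_add]
            gcongr ?_ * (?_ * ?_)
            exact pow_le_pow_of_le_one hp0 hp1 (by omega))
    have heq : phaseIntegral lam u z g (insert k S) B = fun ω => c + z k (ω k) * W ω :=
      funext fun ω => phaseIntegral_insert hz hg hgm hk hmax hB ω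
    rw [mixedMoment_eval μ (hzm k)] at hstep
    have hW := ihS hS' B₂ hB₂ hblock'
    rw [heq]
    refine hstep.trans ?_
    rw [hab]
    have hRe : (2 : ℝ) ^ d * (lam.real B₁ * (4 ^ ((d - 1) ^ 2) * p ^ (d / 2)))
        = lam.real B₁ * (R * p ^ (d / 2)) := by rw [hR]; ring
    rw [hRe]
    split_ifs at hW ⊢ with hab'
    · have hd2 : d / 2 = (d + 1) / 2 := by omega
      have hBB : lam.real B₂ + lam.real B₁ = lam.real B := by
        rw [add_comm, ← measureReal_inter_add_sdiff (s := B) (t := Set.Ioi (u k)) measurableSet_Ioi,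
          Set.sdiff_eq, Set.compl_Ioi]
      have hZ1 : ‖mixedMoment (μ k) (z k) a b‖ ≤ 1 := by
        refine (norm_integral_le_of_norm_le_const (C := 1)
          (ae_of_all _ fun t => norm_pow_mul_conj_pow_le (hz k t) a b)).trans (by simp)
      rw [hd2, ← hBB, add_mul]
      exact add_le_add ((mul_le_of_le_one_left (norm_nonneg _) hZ1).trans hW) le_rfl
    · have hZ1 := hS k (Finset.mem_insert_self k S) a b hab' (by omega)
      have h3 : lam.real B₁ * (R * p ^ (d / 2)) ≤ R * p ^ ((d + 1) / 2) := by
        calc _ ≤ p * (R * p ^ (d / 2)) := by gcongr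
          _ = R * p ^ (d / 2 + 1) := by ring
          _ ≤ _ := by
            gcongr ?_ * ?_
            exact pow_le_pow_of_le_one hp0 hp1 (by omega)
      calc _ ≤ 1 / 2 * (2 * (R * p ^ ((d + 1) / 2))) + R * p ^ ((d + 1) / 2) := by gcongr
        _ = _ := by ring

end

/-! ### The Fourier transform of the random image -/

lemma norm_exp_neg_ofReal_mul_I (t : ℝ) : ‖Complex.exp (-(t : ℂ) * Complex.I)‖ = 1 := by
  rw [← Complex.ofReal_neg, Complex.norm_exp_ofReal_mul_I]

lemma norm_fourierTransform_le_one (μ : Measure ℝ) [IsProbabilityMeasure μ] (ξ : ℝ) :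
    ‖fourierTransform μ ξ‖ ≤ 1 :=
  (norm_integral_le_of_norm_le_const (C := 1)
    (ae_of_all _ fun _ => (norm_exp_neg_ofReal_mul_I _).le)).trans (by simp)

lemma norm_fourierTransform_neg (μ : Measure ℝ) (ξ : ℝ) :
    ‖fourierTransform μ (-ξ)‖ = ‖fourierTransform μ ξ‖ := by
  rw [← RCLike.norm_conj (fourierTransform μ ξ)]
  unfold fourierTransform
  rw [← integral_conj]
  congr 2
  ext x
  rw [← Complex.exp_conj]
  congr 1
  simp only [map_mul, map_neg, Complex.conj_ofReal, Complex.conj_I]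
  push_cast
  ring

section RandomMap

variable {φ : ℝ → ℝ} {E : Set ℝ} {m : ℕ} {α : ℝ}

lemma fourierTransform_map_randomMap (hφ : IsStep φ) (hE : IsCompact E) (hm : 1 ≤ m)
    (hα : α ∈ Set.Icc (0 : ℝ) 1) (lam : Measure ℝ) (ω : Sample m α E) (ξ : ℝ) :
    fourierTransform (lam.map (randomMap φ ω)) ξ
      = ∫ x, Complex.exp (-(2 * Real.pi * ξ * randomMap φ ω x : ℝ) * Complex.I) ∂lam := by
  unfold fourierTransform
  have h : Measurable (randomMap φ ω) :=
    (measurable_randomMap hφ hE hm hα).comp measurable_prodMk_left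
  rw [integral_map h.aemeasurable (Continuous.aestronglyMeasurable (by fun_prop))]

lemma measurable_fourierTransform_map_randomMap (hφ : IsStep φ) (hE : IsCompact E) (hm : 1 ≤ m)
    (hα : α ∈ Set.Icc (0 : ℝ) 1) (lam : Measure ℝ) [IsProbabilityMeasure lam] (ξ : ℝ) :
    Measurable fun ω : Sample m α E => fourierTransform (lam.map (randomMap φ ω)) ξ := by
  simp_rw [fourierTransform_map_randomMap hφ hE hm hα]
  have h1 : Continuous fun t : ℝ => Complex.exp (-(2 * Real.pi * ξ * t : ℝ) * Complex.I) := by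
    fun_prop
  have h2 : Measurable fun p : Sample m α E × ℝ =>
      Complex.exp (-(2 * Real.pi * ξ * randomMap φ p.1 p.2 : ℝ) * Complex.I) :=
    h1.measurable.comp (measurable_randomMap hφ hE hm hα)
  exact (h2.stronglyMeasurable.integral_prod_right (ν := lam)).measurable

/-- The smallest element of the sample space: nothing is inserted into the holes. -/
def zeroSample (m : ℕ) (α : ℝ) (E : Set ℝ) : Sample m α E :=
  fun U => ⟨0, le_rfl, holeDelta_nonneg m α U⟩

open scoped Classical in
/-- On `E`, the coordinates in a finite set `S` of holes displace `x` by the sum of those `ω U` with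
`U` to the left of `x`, i.e. by the total displacement minus that of the holes to the right. -/
lemma randomMap_piecewise (hφ : IsStep φ) (hE : IsCompact E) (hm : 1 ≤ m)
    (hα : α ∈ Set.Icc (0 : ℝ) 1) (S : Finset (holes E)) (ω ω' : Sample m α E) {x : ℝ}
    (hx : x ∈ E) :
    randomMap φ (S.piecewise ω ω') x = randomMap φ (S.piecewise (zeroSample m α E) ω') x
      + ∑ U ∈ S, (ω U : ℝ) - ∑ U ∈ S, if x ≤ sInf (U : Set ℝ) then (ω U : ℝ) else 0 := by
  have h1 : ∀ U : holes E,
      (S.piecewise ω ω' U : ℝ) * φ ((x - sInf (U : Set ℝ)) / Metric.diam (U : Set ℝ))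
        = (S.piecewise (zeroSample m α E) ω' U : ℝ)
            * φ ((x - sInf (U : Set ℝ)) / Metric.diam (U : Set ℝ))
          + if U ∈ S then (ω U : ℝ) * (if x ≤ sInf (U : Set ℝ) then 0 else 1) else 0 := fun U => by
    rw [hφ.eq_ite hE.isClosed U.2 hx]
    by_cases hU : U ∈ S <;> simp [hU, zeroSample]
  have hfin : ∀ U ∉ S,
      (if U ∈ S then (ω U : ℝ) * (if x ≤ sInf (U : Set ℝ) then 0 else 1) else 0) = 0 :=
    fun U hU => if_neg hU
  unfold randomMap
  rw [tsum_congr h1, (summable_randomMap hφ hE hm hα _ x).tsum_add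
    (summable_of_ne_finset_zero hfin), tsum_eq_sum hfin, add_sub_assoc, ← Finset.sum_sub_distrib,
    ← add_assoc]
  congr 1
  refine Finset.sum_congr rfl fun U hU => ?_
  rw [if_pos hU]
  split_ifs <;> simp

open scoped Classical in
lemma norm_fourierTransform_piecewise (hφ : IsStep φ) (hE : IsCompact E) (hm : 1 ≤ m)
    (hα : α ∈ Set.Icc (0 : ℝ) 1) {lam : Measure ℝ} (hlamE : lam Eᶜ = 0) (S : Finset (holes E))
    (ω ω' : Sample m α E) (ξ : ℝ) :
    ‖fourierTransform (lam.map (randomMap φ (S.piecewise ω ω'))) ξ‖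
      = ‖phaseIntegral lam (fun U : holes E => sInf (U : Set ℝ))
          (fun U (t : Set.Icc (0 : ℝ) (holeDelta m α (U : Set ℝ))) =>
            Complex.exp (-(2 * Real.pi * (-ξ) * t : ℝ) * Complex.I))
          (fun x => Complex.exp (-(2 * Real.pi * ξ
            * randomMap φ (S.piecewise (zeroSample m α E) ω') x : ℝ) * Complex.I))
          S Set.univ ω‖ := by
  rw [fourierTransform_map_randomMap hφ hE hm hα, phaseIntegral, Measure.restrict_univ]
  set τ : ℝ := ∑ U ∈ S, (ω U : ℝ) with hτ
  rw [← one_mul ‖∫ x, _ * _ ∂lam‖, ← norm_exp_neg_ofReal_mul_I (2 * Real.pi * ξ * τ), ← norm_mul,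
    ← integral_const_mul]
  congr 1
  refine integral_congr_ae ?_
  have hae : ∀ᵐ x ∂lam, x ∈ E := by
    rw [ae_iff]; exact hlamE
  filter_upwards [hae] with x hx
  rw [randomMap_piecewise hφ hE hm hα S ω ω' hx]
  have h1 : ∀ U : holes E, (if x ≤ sInf (U : Set ℝ) then
        Complex.exp (-(2 * Real.pi * (-ξ) * (ω U : ℝ) : ℝ) * Complex.I) else 1)
      = Complex.exp (-(2 * Real.pi * (-ξ) * (if x ≤ sInf (U : Set ℝ) then (ω U : ℝ) else 0) : ℝ)
          * Complex.I) := fun U => by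
    split_ifs <;> simp
  simp_rw [h1]
  rw [← Complex.exp_sum, ← Complex.exp_add, ← Complex.exp_add]
  congr 1
  rw [← Finset.sum_mul, Finset.sum_neg_distrib, ← Complex.ofReal_sum, ← Finset.mul_sum, ← hτ]
  push_cast
  ring

lemma mixedMoment_exp_coordLaw (ν : Measure (Set.Icc (0 : ℝ) 1)) (U : Set ℝ) (ξ : ℝ) (a b : ℕ) :
    mixedMoment (coordLaw ν m α U)
      (fun t => Complex.exp (-(2 * Real.pi * ξ * t : ℝ) * Complex.I)) a b
      = fourierTransform (ν.map Subtype.val) (((a : ℝ) - b) * ξ * holeDelta m α U) := by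
  have hc : Continuous fun t : Set.Icc (0 : ℝ) (holeDelta m α U) =>
      Complex.exp (-(2 * Real.pi * ξ * t : ℝ) * Complex.I) := by fun_prop
  unfold mixedMoment fourierTransform coordLaw
  rw [integral_map (measurable_scale m α U).aemeasurable
      (measurable_pow_mul_conj_pow hc.measurable a b).aestronglyMeasurable,
    integral_map measurable_subtype_coe.aemeasurable
      (Continuous.aestronglyMeasurable (by fun_prop))]
  congr 1
  ext x
  rw [← Complex.exp_conj, ← Complex.exp_nat_mul, ← Complex.exp_nat_mul, ← Complex.exp_add]
  congr 1
  simp only [map_mul, map_neg, Complex.conj_ofReal, Complex.conj_I, scale]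
  push_cast
  ring

end RandomMap

/-- Both cases of `delta` are at least `t ^ (α + ε)`, up to a constant. -/
lemma exists_le_delta {α ε : ℝ} (hε : 0 < ε) :
    ∃ c : ℝ, 0 < c ∧ ∀ t : ℝ, 0 < t → t ≤ 1 → c * t ^ (α + ε) ≤ delta α t := by
  have h2 : (0 : ℝ) < Real.log 2 := Real.log_pos (by norm_num)
  unfold delta
  split_ifs with h
  · have hK : 0 < max (1 / ε) (Real.log 2) := lt_max_of_lt_right h2
    refine ⟨1 / max (1 / ε) (Real.log 2), by positivity, fun t ht ht1 => ?_⟩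
    have htε : 0 < t ^ ε := Real.rpow_pos_of_pos ht _
    have htε1 : t ^ ε ≤ 1 := Real.rpow_le_one ht.le ht1 hε.le
    rw [h, zero_add, div_mul_eq_mul_div, one_mul,
      div_le_div_iff₀ hK (lt_max_of_lt_right h2), one_mul, ← le_div_iff₀' htε]
    refine max_le ?_ ?_
    · have := Real.log_le_rpow_div (inv_pos.2 ht).le hε
      rw [Real.log_inv, Real.inv_rpow ht.le] at this
      refine this.trans ?_
      rw [div_eq_mul_inv, mul_comm, inv_eq_one_div ε, ← div_eq_mul_inv]
      gcongr
      exact le_max_left _ _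
    · rw [le_div_iff₀ htε]
      calc Real.log 2 * t ^ ε ≤ Real.log 2 * 1 := by gcongr
        _ ≤ _ := by rw [mul_one]; exact le_max_right _ _
  · exact ⟨1, one_pos, fun t ht ht1 => by
      rw [one_mul]; exact Real.rpow_le_rpow_of_exponent_ge ht ht1 (by linarith)⟩

lemma exists_forall_norm_le_half {f : ℝ → ℂ} (hf : Filter.Tendsto f (Filter.cocompact ℝ) (nhds 0)) :
    ∃ T : ℝ, 0 < T ∧ ∀ ξ, T ≤ |ξ| → ‖f ξ‖ ≤ 1 / 2 := by
  have h := hf.eventually (Metric.ball_mem_nhds (0 : ℂ) (by norm_num : (0 : ℝ) < 1 / 2))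
  rw [cocompact_eq_atBot_atTop, Filter.eventually_sup, Filter.eventually_atBot,
    Filter.eventually_atTop] at h
  obtain ⟨⟨a, ha⟩, b, hb⟩ := h
  refine ⟨max 1 (max (-a) b), by positivity, fun ξ hξ => ?_⟩
  have h1 : -a ≤ |ξ| := ((le_max_left _ _).trans (le_max_right _ _)).trans hξ
  have h2 : b ≤ |ξ| := ((le_max_right _ _).trans (le_max_right _ _)).trans hξ
  rcases abs_cases ξ with ⟨h, -⟩ | ⟨h, -⟩
  · have := hb ξ (by rwa [h] at h2)
    rw [dist_zero_right] at this
    exact this.le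
  · have := ha ξ (by rw [h] at h1; linarith)
    rw [dist_zero_right] at this
    exact this.le

/-! ### Moments of the Fourier transform -/

lemma mixedMoment_self {Ω : Type*} [MeasurableSpace Ω] (P : Measure Ω) (Y : Ω → ℂ) (q : ℕ) :
    mixedMoment P Y q q = ((∫ ω, ‖Y ω‖ ^ (2 * q) ∂P : ℝ) : ℂ) := by
  unfold mixedMoment
  rw [← integral_complex_ofReal]
  congr 1
  ext ω
  rw [← mul_pow, Complex.mul_conj, Complex.normSq_eq_norm_sq, pow_mul, Complex.ofReal_pow,
    Complex.ofReal_pow, Complex.ofReal_pow]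

lemma sub_lt_of_not_separated {E : Set ℝ} {κ : ℝ} (hκ : 0 < κ)
    (hpor : ∀ x ∈ E, ∀ y ∈ E, x < y →
      ∃ u v, x ≤ u ∧ u < v ∧ v ≤ y ∧ IsGap E u v ∧ κ * (y - x) ≤ v - u)
    {r : ℝ} {T : Set ℝ}
    (hT : ∀ x ∈ T, ∀ y ∈ T, ∀ U : holes E, r ≤ Metric.diam (U : Set ℝ) →
      (x ≤ sInf (U : Set ℝ) ↔ y ≤ sInf (U : Set ℝ))) {x y : ℝ} (hx : x ∈ T ∩ E) (hy : y ∈ T ∩ E)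
    (hxy : x < y) : y - x < r / κ := by
  obtain ⟨u, v, hxu, huv, hvy, hgap, hκuv⟩ := hpor x hx.2 y hy.2 hxy
  by_contra! h
  rw [div_le_iff₀ hκ] at h
  have h1 := hT x hx.1 y hy.1 ⟨_, Ioo_mem_holes huv hgap⟩ (by
    rw [Real.diam_Ioo huv.le]; linarith)
  simp only [csInf_Ioo huv] at h1
  linarith [h1.1 hxu]

/-- Points of `E` not separated by a hole of size at least `r` form a set of mass `O (r ^ s)`. -/
lemma measureReal_block_le {E : Set ℝ} {κ : ℝ} (hκ : 0 < κ)
    (hpor : ∀ x ∈ E, ∀ y ∈ E, x < y →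
      ∃ u v, x ≤ u ∧ u < v ∧ v ≤ y ∧ IsGap E u v ∧ κ * (y - x) ≤ v - u)
    {lam : Measure ℝ} [IsProbabilityMeasure lam] (hlamE : lam Eᶜ = 0)
    {A s : ℝ} (hA : 0 ≤ A)
    (hlam : ∀ p q : ℝ, p ≤ q → lam.real (Set.Icc p q) ≤ A * (q - p) ^ s) {r : ℝ} (hr : 0 < r)
    {T : Set ℝ} (hT : ∀ x ∈ T, ∀ y ∈ T, ∀ U : holes E, r ≤ Metric.diam (U : Set ℝ) →
      (x ≤ sInf (U : Set ℝ) ↔ y ≤ sInf (U : Set ℝ))) :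
    lam.real T ≤ A * (2 * r / κ) ^ s := by
  have hTE : lam.real T ≤ lam.real (T ∩ E) := by
    have h1 : lam.real T ≤ lam.real ((T ∩ E) ∪ Eᶜ) := measureReal_mono fun x hx => by
      by_cases h : x ∈ E
      · exact Or.inl ⟨hx, h⟩
      · exact Or.inr h
    have h2 : lam.real Eᶜ = 0 := by rw [measureReal_def, hlamE]; rfl
    linarith [measureReal_union_le (μ := lam) (T ∩ E) Eᶜ]
  refine hTE.trans ?_
  have hrκ : 0 < r / κ := div_pos hr hκ
  rcases (T ∩ E).eq_empty_or_nonempty with h | ⟨x, hx⟩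
  · rw [h, measureReal_empty]; positivity
  · have hsub : T ∩ E ⊆ Set.Icc (x - r / κ) (x + r / κ) := fun y hy => by
      rcases lt_trichotomy x y with h | h | h
      · have := sub_lt_of_not_separated hκ hpor hT hx hy h
        constructor <;> linarith
      · constructor <;> linarith
      · have := sub_lt_of_not_separated hκ hpor hT hy hx h
        constructor <;> linarith
    refine (measureReal_mono hsub).trans ((hlam _ _ (by linarith)).trans_eq ?_)
    congr 2; ring

/-- The key estimate: at frequency `ξ`, the holes whose displacement `ω U` varies on a scale larger
than `1 / ξ` are those of size at least `r ≈ ξ ^ (-1 / (m + α + ε))`; conditionally on the smaller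
holes, the `2 q`-th moment of the Fourier transform is `O ((r ^ s) ^ q)`. -/
lemma exists_moment_le {φ : ℝ → ℝ} (hφ : IsStep φ) {E : Set ℝ} (hE : IsCompact E) {m : ℕ}
    (hm : 1 ≤ m) {α : ℝ} (hα : α ∈ Set.Icc (0 : ℝ) 1) {κ : ℝ} (hκ : 0 < κ)
    (hpor : ∀ x ∈ E, ∀ y ∈ E, x < y →
      ∃ u v, x ≤ u ∧ u < v ∧ v ≤ y ∧ IsGap E u v ∧ κ * (y - x) ≤ v - u)
    (ν : Measure (Set.Icc (0 : ℝ) 1)) [IsProbabilityMeasure ν]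
    (hν : Filter.Tendsto (fourierTransform (ν.map Subtype.val)) (Filter.cocompact ℝ) (nhds 0))
    {lam : Measure ℝ} [IsProbabilityMeasure lam] (hlamE : lam Eᶜ = 0) {A s : ℝ} (hA : 0 ≤ A)
    (hlam : ∀ p q : ℝ, p ≤ q → lam.real (Set.Icc p q) ≤ A * (q - p) ^ s) {ε : ℝ} (hε : 0 < ε)
    (q : ℕ) :
    ∃ C ξ₀ : ℝ, 0 < ξ₀ ∧ ∀ ξ, ξ₀ ≤ ξ →
      ∫ ω, ‖fourierTransform (lam.map (randomMap φ ω)) ξ‖ ^ (2 * q) ∂sampleLaw ν m α E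
        ≤ C * ξ ^ (-(s / (m + α + ε)) * q) := by
  classical
  obtain ⟨T, hT0, hT⟩ := exists_forall_norm_le_half hν
  obtain ⟨c, hc0, hc⟩ := exists_le_delta (α := α) hε
  have hσ : 0 < m + α + ε := by
    have := hα.1
    positivity
  set σ : ℝ := m + α + ε
  refine ⟨4 ^ ((2 * q) ^ 2) * (A * (2 / κ) ^ s * (T / c) ^ (s / σ)) ^ q, T / c, by positivity,
    fun ξ hξ => ?_⟩
  have hξ0 : 0 < ξ := lt_of_lt_of_le (by positivity) hξ
  -- the critical size
  set r : ℝ := (T / (c * ξ)) ^ (1 / σ) with hr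
  have hTc : 0 < T / (c * ξ) := by positivity
  have hr0 : 0 < r := Real.rpow_pos_of_pos hTc _
  have hr1 : r ≤ 1 := by
    refine Real.rpow_le_one hTc.le ?_ (by positivity)
    rw [div_le_one (by positivity)]
    rwa [div_le_iff₀ hc0, mul_comm] at hξ
  have hrσ : c * r ^ σ = T / ξ := by
    rw [hr, ← Real.rpow_mul hTc.le, one_div_mul_cancel hσ.ne', Real.rpow_one]
    field_simp
  have hrd : T / ξ ≤ r ^ m * delta α r := by
    calc T / ξ = r ^ m * (c * r ^ (α + ε)) := by
          rw [← hrσ, show σ = m + (α + ε) by simp only [σ]; ring, Real.rpow_add hr0,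
            Real.rpow_natCast]
          ring
      _ ≤ _ := by
        gcongr
        exact hc r hr0 hr1
  set p : ℝ := A * (2 * r / κ) ^ s with hp
  have hp0 : 0 ≤ p := by positivity
  have hfin : {U : holes E | r ≤ Metric.diam (U : Set ℝ)}.Finite := by
    have := (summable_diam_holes hE).tendsto_cofinite_zero.eventually (gt_mem_nhds hr0)
    rw [Filter.eventually_cofinite] at this
    simpa only [not_lt] using this
  set S : Finset (holes E) := hfin.toFinset
  have hSmem : ∀ U : holes E, U ∈ S ↔ r ≤ Metric.diam (U : Set ℝ) := fun U => by simp [S]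
  set z : ∀ U : holes E, Set.Icc (0 : ℝ) (holeDelta m α (U : Set ℝ)) → ℂ := fun U t =>
    Complex.exp (-(2 * Real.pi * (-ξ) * t : ℝ) * Complex.I)
  have hzm : ∀ U, Measurable (z U) := fun U => by
    have : Continuous (z U) := by fun_prop
    exact this.measurable
  set X : Sample m α E → ℂ := fun ω => fourierTransform (lam.map (randomMap φ ω)) ξ
  have hXm : Measurable X := measurable_fourierTransform_map_randomMap hφ hE hm hα lam ξ
  have hX1 : ∀ ω, ‖X ω‖ ≤ 1 := fun ω => by
    have : IsProbabilityMeasure (lam.map (randomMap φ ω)) := Measure.isProbabilityMeasure_map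
      ((measurable_randomMap hφ hE hm hα).comp measurable_prodMk_left).aemeasurable
    exact norm_fourierTransform_le_one _ ξ
  have hbound : ∫ ω, ‖X ω‖ ^ (2 * q) ∂sampleLaw ν m α E ≤ 4 ^ ((2 * q) ^ 2) * p ^ q := by
    rcases le_or_gt p 1 with hp1 | hp1
    · have hmp := measurePreserving_piecewise
        (fun U : holes E => coordLaw ν m α (U : Set ℝ)) S
      have hXX : Measurable fun w : Sample m α E × Sample m α E =>
          ‖X (S.piecewise w.1 w.2)‖ ^ (2 * q) := (hXm.comp hmp.measurable).norm.pow_const _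
      calc ∫ ω, ‖X ω‖ ^ (2 * q) ∂sampleLaw ν m α E
          = ∫ w, ‖X (S.piecewise w.1 w.2)‖ ^ (2 * q)
              ∂(sampleLaw ν m α E).prod (sampleLaw ν m α E) := by
            unfold sampleLaw
            conv_lhs => rw [← hmp.map_eq]
            exact integral_map hmp.measurable.aemeasurable
              (hXm.norm.pow_const _).aestronglyMeasurable
        _ = ∫ ω', ∫ ω, ‖X (S.piecewise ω ω')‖ ^ (2 * q) ∂sampleLaw ν m α E
              ∂sampleLaw ν m α E := by
            have : IsProbabilityMeasure (sampleLaw ν m α E) := by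
              unfold sampleLaw; infer_instance
            refine integral_prod_symm _ (Integrable.of_bound hXX.aestronglyMeasurable 1
              (ae_of_all _ fun w => ?_))
            rw [norm_pow, norm_norm]
            exact pow_le_one₀ (norm_nonneg _) (hX1 _)
        _ ≤ ‖∫ ω', ∫ ω, ‖X (S.piecewise ω ω')‖ ^ (2 * q) ∂sampleLaw ν m α E
              ∂sampleLaw ν m α E‖ := le_abs_self _
        _ ≤ _ := by
          have : IsProbabilityMeasure (sampleLaw ν m α E) := by
            unfold sampleLaw; infer_instance
          refine (norm_integral_le_of_norm_le_const (C := 4 ^ ((2 * q) ^ 2) * p ^ q)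
            (ae_of_all _ fun ω' => ?_)).trans (by simp)
          simp only [X, norm_fourierTransform_piecewise hφ hE hm hα hlamE S _ ω' ξ]
          have hgm : Measurable fun x => Complex.exp (-(2 * Real.pi * ξ
              * randomMap φ (S.piecewise (zeroSample m α E) ω') x : ℝ) * Complex.I) := by
            have h1 : Continuous fun t : ℝ =>
                Complex.exp (-(2 * Real.pi * ξ * t : ℝ) * Complex.I) := by fun_prop
            exact h1.measurable.comp
              ((measurable_randomMap hφ hE hm hα).comp measurable_prodMk_left)
          have := norm_mixedMoment_phaseIntegral_le (lam := lam)
            (u := fun U : holes E => sInf (U : Set ℝ)) (z := z)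
            (fun U : holes E => coordLaw ν m α (U : Set ℝ))
            (fun U t => (norm_exp_neg_ofReal_mul_I _).le) hzm
            (fun x => (norm_exp_neg_ofReal_mul_I _).le) hgm hp0 hp1 (n := 2 * q) (2 * q) le_rfl S
            (fun U hU a b hab _ => by
              rw [mixedMoment_exp_coordLaw]
              refine hT _ ?_
              have hge := hrd.trans (holeDelta_ge hα.1 m hr0 ((hSmem U).1 hU))
              rw [div_le_iff₀ hξ0] at hge
              have h1 : (1 : ℝ) ≤ |(a : ℝ) - b| := by
                have : (1 : ℤ) ≤ |(a : ℤ) - b| := Int.one_le_abs (by omega)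
                exact_mod_cast this
              rw [abs_mul, abs_mul, abs_neg, abs_of_pos hξ0,
                abs_of_nonneg (holeDelta_nonneg m α _)]
              have h2 := holeDelta_nonneg m α (U : Set ℝ)
              calc T ≤ holeDelta m α U * ξ := hge
                _ = 1 * ξ * holeDelta m α U := by ring
                _ ≤ _ := by gcongr)
            Set.univ MeasurableSet.univ
            (fun B _ _ hB => measureReal_block_le hκ hpor hlamE hA hlam hr0
              fun x hx y hy U hU => hB x hx y hy U ((hSmem U).2 hU)) q q (by ring)
          rw [mixedMoment_self, Complex.norm_real, show (2 * q + 1) / 2 = q by omega] at this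
          exact this
    · have : IsProbabilityMeasure (sampleLaw ν m α E) := by
        unfold sampleLaw; infer_instance
      calc ∫ ω, ‖X ω‖ ^ (2 * q) ∂sampleLaw ν m α E
          ≤ ‖∫ ω, ‖X ω‖ ^ (2 * q) ∂sampleLaw ν m α E‖ := le_abs_self _
        _ ≤ 1 := by
          refine (norm_integral_le_of_norm_le_const (C := 1)
            (ae_of_all _ fun ω => ?_)).trans (by simp)
          rw [norm_pow, norm_norm]
          exact pow_le_one₀ (norm_nonneg _) (hX1 _)
        _ ≤ _ := one_le_mul_of_one_le_of_one_le (one_le_pow₀ (by norm_num))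
          (one_le_pow₀ hp1.le)
  refine hbound.trans_eq ?_
  have hpξ : p = A * (2 / κ) ^ s * (T / c) ^ (s / σ) * ξ ^ (-(s / σ)) := by
    rw [hp, mul_div_right_comm, Real.mul_rpow (by positivity) hr0.le, hr, ← Real.rpow_mul hTc.le,
      one_div_mul_eq_div, ← div_div, Real.div_rpow (by positivity) hξ0.le, Real.rpow_neg hξ0.le]
    ring
  rw [hpξ, mul_pow _ (ξ ^ _), ← Real.rpow_natCast (ξ ^ _), ← Real.rpow_mul hξ0.le]
  ring

/-! ### Almost sure decay -/

/-- A measure on a bounded set of the line cannot satisfy a Frostman condition of exponent larger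
than `1`. -/
lemma exponent_le_one {E : Set ℝ} (hE : IsCompact E) {lam : Measure ℝ} [IsProbabilityMeasure lam]
    (hlamE : lam Eᶜ = 0) {A s : ℝ}
    (hlam : ∀ p q : ℝ, p ≤ q → lam.real (Set.Icc p q) ≤ A * (q - p) ^ s) : s ≤ 1 := by
  by_contra! hs
  obtain ⟨R, hR⟩ := hE.isBounded.subset_closedBall (0 : ℝ)
  rw [Real.closedBall_eq_Icc, zero_sub, zero_add] at hR
  set R' := max R 1
  have hR'0 : 0 < R' := lt_max_of_lt_right one_pos
  have hR' : E ⊆ Set.Icc (-R') R' := hR.trans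
    (Set.Icc_subset_Icc (neg_le_neg (le_max_left _ _)) (le_max_left _ _))
  have hone : 1 ≤ lam.real (Set.Icc (-R') R') := by
    have h1 : lam.real (Set.Icc (-R') R')ᶜ = 0 := by
      rw [measureReal_def, measure_mono_null (Set.compl_subset_compl.2 hR') hlamE]; rfl
    have h2 := probReal_compl_eq_one_sub (μ := lam) (measurableSet_Icc (a := -R') (b := R'))
    linarith
  have hstep : ∀ h : ℝ, 0 ≤ h → ∀ k : ℕ,
      lam.real (Set.Icc (-R') (-R' + (k + 1) * h)) ≤ (k + 1) * (A * h ^ s) := fun h hh k => by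
    induction k with
    | zero => simpa using hlam (-R') (-R' + h) (by linarith)
    | succ k ih =>
      have h1 : Set.Icc (-R') (-R' + ((k + 1 : ℕ) + 1) * h) ⊆ Set.Icc (-R') (-R' + (k + 1) * h)
          ∪ Set.Icc (-R' + (k + 1) * h) (-R' + (k + 1) * h + h) := fun x hx => by
        rcases le_total x (-R' + (k + 1) * h) with h' | h'
        · exact Or.inl ⟨hx.1, h'⟩
        · refine Or.inr ⟨h', hx.2.trans_eq ?_⟩
          push_cast; ring
      have h2 := hlam (-R' + (k + 1) * h) (-R' + (k + 1) * h + h) (by linarith)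
      rw [add_sub_cancel_left] at h2
      have h3 := (measureReal_mono (μ := lam) h1).trans (measureReal_union_le _ _)
      push_cast at h3 ⊢
      linarith
  have hle : ∀ k : ℕ, 1 ≤ A * (2 * R') ^ s * ((k + 1 : ℕ) : ℝ) ^ (-(s - 1)) := fun k => by
    have hk : (0 : ℝ) < (k + 1 : ℕ) := by positivity
    have h1 := hstep (2 * R' / (k + 1 : ℕ)) (by positivity) k
    rw [show -R' + ((k : ℝ) + 1) * (2 * R' / (k + 1 : ℕ)) = R' by push_cast; field_simp; ring] at h1
    refine hone.trans (h1.trans_eq ?_)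
    rw [Real.div_rpow (by positivity) hk.le, neg_sub, Real.rpow_sub hk, Real.rpow_one]
    push_cast
    ring
  have hlim : Filter.Tendsto (fun k : ℕ => A * (2 * R') ^ s * ((k + 1 : ℕ) : ℝ) ^ (-(s - 1)))
      Filter.atTop (nhds (A * (2 * R') ^ s * 0)) :=
    (((tendsto_rpow_neg_atTop (sub_pos.2 hs)).comp tendsto_natCast_atTop_atTop).comp
      (Filter.tendsto_add_atTop_nat 1)).const_mul _
  have := ge_of_tendsto' hlim hle
  norm_num at this

lemma norm_exp_sub_exp_le (a b : ℝ) :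
    ‖Complex.exp (-(a : ℂ) * Complex.I) - Complex.exp (-(b : ℂ) * Complex.I)‖ ≤ |a - b| := by
  have h : Complex.exp (-(a : ℂ) * Complex.I) - Complex.exp (-(b : ℂ) * Complex.I)
      = Complex.exp (-(b : ℂ) * Complex.I) * (Complex.exp (Complex.I * ((b - a : ℝ) : ℂ)) - 1) := by
    rw [mul_sub, ← Complex.exp_add, mul_one]
    congr 2
    push_cast
    ring
  rw [h, norm_mul, norm_exp_neg_ofReal_mul_I, one_mul, abs_sub_comm]
  exact Real.norm_exp_I_mul_ofReal_sub_one_le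

/-- The Fourier transform of a measure of bounded support is Lipschitz. -/
lemma norm_fourierTransform_sub_le {μ : Measure ℝ} [IsProbabilityMeasure μ] {R : ℝ}
    (hR : ∀ᵐ x ∂μ, |x| ≤ R) (ξ η : ℝ) :
    ‖fourierTransform μ ξ - fourierTransform μ η‖ ≤ 2 * Real.pi * R * |ξ - η| := by
  have hint : ∀ ζ : ℝ,
      Integrable (fun x : ℝ => Complex.exp (-(2 * Real.pi * ζ * x : ℝ) * Complex.I)) μ := fun ζ =>
    Integrable.of_bound (Continuous.aestronglyMeasurable (by fun_prop)) 1
      (ae_of_all _ fun _ => (norm_exp_neg_ofReal_mul_I _).le)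
  unfold fourierTransform
  rw [← integral_sub (hint ξ) (hint η)]
  refine (norm_integral_le_of_norm_le_const (C := 2 * Real.pi * R * |ξ - η|) ?_).trans (by simp)
  filter_upwards [hR] with x hx
  refine (norm_exp_sub_exp_le _ _).trans ?_
  rw [show 2 * Real.pi * ξ * x - 2 * Real.pi * η * x = 2 * Real.pi * x * (ξ - η) by ring, abs_mul,
    abs_mul, abs_of_pos Real.two_pi_pos]
  have := Real.pi_pos
  gcongr

/-- Decay along the frequencies `√n`, whose spacing near `ξ` is less than `1 / ξ`, gives decay at
all frequencies. -/
lemma exists_decay_of_sqrt {f : ℝ → ℂ} (h1 : ∀ ξ, ‖f ξ‖ ≤ 1) (hneg : ∀ ξ, ‖f (-ξ)‖ = ‖f ξ‖)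
    {L : ℝ} (hL : 0 ≤ L) (hlip : ∀ ξ η, ‖f ξ - f η‖ ≤ L * |ξ - η|) {t : ℝ}
    (ht : t ∈ Set.Icc (0 : ℝ) 1) {K : ℝ} {n₀ : ℕ}
    (hK : ∀ n : ℕ, n₀ ≤ n → ‖f (√n)‖ * (√n) ^ (t / 2) ≤ K) :
    ∃ C : ℝ, ∀ ξ, ξ ≠ 0 → ‖f ξ‖ ≤ C * |ξ| ^ (-t / 2) := by
  obtain ⟨ht0, ht1⟩ := ht
  have hK0 : 0 ≤ K := le_trans (by positivity) (hK n₀ le_rfl)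
  suffices h : ∀ ξ, 0 < ξ → ‖f ξ‖ ≤ (2 * K + L + (n₀ + 2)) * ξ ^ (-t / 2) by
    refine ⟨2 * K + L + (n₀ + 2), fun ξ hξ => ?_⟩
    rcases lt_or_gt_of_ne hξ with h' | h'
    · rw [abs_of_neg h', ← hneg]; exact h _ (neg_pos.2 h')
    · rw [abs_of_pos h']; exact h _ h'
  intro ξ hξ
  have hpos : 0 < ξ ^ (-t / 2) := Real.rpow_pos_of_pos hξ _
  rcases lt_or_ge ξ (n₀ + 2) with hlt | hge
  · have h2 : 1 ≤ (n₀ + 2) * ξ ^ (-t / 2) := by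
      have h3 : ξ ^ (t / 2) ≤ n₀ + 2 := by
        calc ξ ^ (t / 2) ≤ ((n₀ : ℝ) + 2) ^ (t / 2) := by gcongr
          _ ≤ ((n₀ : ℝ) + 2) ^ (1 : ℝ) :=
            Real.rpow_le_rpow_of_exponent_le (by linarith [n₀.cast_nonneg (α := ℝ)]) (by linarith)
          _ = _ := Real.rpow_one _
      calc (1 : ℝ) = ξ ^ (t / 2) * ξ ^ (-t / 2) := by
            rw [← Real.rpow_add hξ, neg_div, add_neg_cancel, Real.rpow_zero]
        _ ≤ _ := by gcongr
    refine (h1 ξ).trans (h2.trans (mul_le_mul_of_nonneg_right ?_ hpos.le))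
    linarith
  · have hn₀ : (0 : ℝ) ≤ n₀ := n₀.cast_nonneg
    set n : ℕ := ⌊ξ ^ 2⌋₊
    have hn1 : (n : ℝ) ≤ ξ ^ 2 := Nat.floor_le (sq_nonneg ξ)
    have hn2 : ξ ^ 2 < n + 1 := Nat.lt_floor_add_one _
    have hnn : n₀ ≤ n := Nat.le_floor (by nlinarith)
    have hs1 : √(n : ℝ) ≤ ξ := Real.sqrt_le_iff.2 ⟨hξ.le, hn1⟩
    have hs2 : ξ / 2 ≤ √(n : ℝ) := Real.le_sqrt_of_sq_le (by nlinarith)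
    have hs0 : 0 < √(n : ℝ) := by linarith
    have hgap : ξ - √(n : ℝ) ≤ ξ⁻¹ := by
      rw [← one_div, le_div_iff₀ hξ]
      nlinarith [Real.sq_sqrt (n.cast_nonneg (α := ℝ))]
    have ha : ‖f (√n)‖ ≤ 2 * K * ξ ^ (-t / 2) := by
      have h2 : ξ ^ (t / 2) ≤ 2 * (√n) ^ (t / 2) := by
        calc ξ ^ (t / 2) ≤ (2 * √n) ^ (t / 2) := by
              gcongr
              linarith
          _ = 2 ^ (t / 2) * (√n) ^ (t / 2) := Real.mul_rpow (by norm_num) hs0.le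
          _ ≤ 2 ^ (1 : ℝ) * (√n) ^ (t / 2) := by
            gcongr ?_ * _
            exact Real.rpow_le_rpow_of_exponent_le (by norm_num) (by linarith)
          _ = _ := by rw [Real.rpow_one]
      rw [neg_div, Real.rpow_neg hξ.le, ← div_eq_mul_inv, le_div_iff₀ (by positivity)]
      calc ‖f (√n)‖ * ξ ^ (t / 2) ≤ ‖f (√n)‖ * (2 * (√n) ^ (t / 2)) := by gcongr
        _ = 2 * (‖f (√n)‖ * (√n) ^ (t / 2)) := by ring
        _ ≤ _ := by linarith [hK n hnn]
    have hb : ‖f ξ - f (√n)‖ ≤ L * ξ ^ (-t / 2) := by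
      refine (hlip ξ (√n)).trans ?_
      rw [abs_of_nonneg (by linarith)]
      gcongr
      refine hgap.trans ?_
      rw [← Real.rpow_neg_one]
      exact Real.rpow_le_rpow_of_exponent_le (by linarith) (by linarith)
    calc ‖f ξ‖ = ‖f (√n) + (f ξ - f (√n))‖ := by rw [add_sub_cancel]
      _ ≤ ‖f (√n)‖ + ‖f ξ - f (√n)‖ := norm_add_le _ _
      _ ≤ (2 * K + L) * ξ ^ (-t / 2) := by linarith
      _ ≤ _ := mul_le_mul_of_nonneg_right (by linarith) hpos.le

/-- A sequence of nonnegative random variables with summable expectations is almost surely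
bounded. -/
lemma ae_bounded_of_summable_integral {Ω : Type*} [MeasurableSpace Ω] {P : Measure Ω}
    {Y : ℕ → Ω → ℝ} (hY : ∀ n, Measurable (Y n)) (hY0 : ∀ n ω, 0 ≤ Y n ω)
    (hint : ∀ n, Integrable (Y n) P) {b : ℕ → ℝ} (hb : Summable b)
    (hYb : ∀ n, ∫ ω, Y n ω ∂P ≤ b n) : ∀ᵐ ω ∂P, ∃ K, ∀ n, Y n ω ≤ K := by
  have h1 : ∀ n, ∫⁻ ω, ENNReal.ofReal (Y n ω) ∂P ≤ ENNReal.ofReal (b n) := fun n => by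
    rw [← ofReal_integral_eq_lintegral_ofReal (hint n) (ae_of_all _ (hY0 n))]
    exact ENNReal.ofReal_le_ofReal (hYb n)
  have hb0 : ∀ n, 0 ≤ b n := fun n => (integral_nonneg (hY0 n)).trans (hYb n)
  have h2 : ∫⁻ ω, ∑' n, ENNReal.ofReal (Y n ω) ∂P ≠ ⊤ := by
    rw [lintegral_tsum fun n => (hY n).ennreal_ofReal.aemeasurable]
    refine ((ENNReal.tsum_le_tsum h1).trans_lt ?_).ne
    rw [← ENNReal.ofReal_tsum_of_nonneg hb0 hb]
    exact ENNReal.ofReal_lt_top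
  filter_upwards [ae_lt_top (Measurable.tsum fun n => (hY n).ennreal_ofReal) h2] with ω hω
  exact ⟨_, fun n => (ENNReal.ofReal_le_iff_le_toReal hω.ne).1
    (ENNReal.le_tsum (f := fun n => ENNReal.ofReal (Y n ω)) n)⟩

/-- Almost sure decay of the Fourier transform for each exponent below the bound. -/
lemma ae_exists_decay {φ : ℝ → ℝ} (hφ : IsStep φ) {E : Set ℝ} (hE : IsCompact E) {m : ℕ}
    (hm : 1 ≤ m) {α : ℝ} (hα : α ∈ Set.Icc (0 : ℝ) 1) {κ : ℝ} (hκ : 0 < κ)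
    (hpor : ∀ x ∈ E, ∀ y ∈ E, x < y →
      ∃ u v, x ≤ u ∧ u < v ∧ v ≤ y ∧ IsGap E u v ∧ κ * (y - x) ≤ v - u)
    (ν : Measure (Set.Icc (0 : ℝ) 1)) [IsProbabilityMeasure ν]
    (hν : Filter.Tendsto (fourierTransform (ν.map Subtype.val)) (Filter.cocompact ℝ) (nhds 0))
    {lam : Measure ℝ} [IsProbabilityMeasure lam] (hlamE : lam Eᶜ = 0) {A s : ℝ} (hA : 0 ≤ A)
    (hlam : ∀ p q : ℝ, p ≤ q → lam.real (Set.Icc p q) ≤ A * (q - p) ^ s) {t : ℝ}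
    (ht : t ∈ Set.Icc (0 : ℝ) 1) (hts : t < s / (m + α)) :
    ∀ᵐ ω ∂sampleLaw ν m α E, ∃ C : ℝ, ∀ ξ, ξ ≠ 0 →
      ‖fourierTransform (lam.map (randomMap φ ω)) ξ‖ ≤ C * |ξ| ^ (-t / 2) := by
  have hP : IsProbabilityMeasure (sampleLaw ν m α E) := by unfold sampleLaw; infer_instance
  have hmα : 0 < m + α := by
    have := hα.1
    positivity
  -- `ε` so small that `t` is still below the exponent at scale `ε`, and then `q` so large that the
  -- moments of order `2 q` are summable over the frequencies `√n`
  rw [lt_div_iff₀ hmα] at hts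
  obtain ⟨ε, hε, hε'⟩ : ∃ ε : ℝ, 0 < ε ∧ t < s / (m + α + ε) := by
    refine ⟨(s - t * (m + α)) / 2, by linarith, ?_⟩
    rw [lt_div_iff₀ (by linarith)]
    nlinarith [ht.1, ht.2]
  set τ : ℝ := s / (m + α + ε)
  obtain ⟨q, hq⟩ := exists_nat_gt (2 / (τ - t))
  have hτt : 0 < τ - t := by linarith
  rw [div_lt_iff₀ hτt] at hq
  obtain ⟨C, ξ₀, hξ₀, hC⟩ :=
    exists_moment_le hφ hE hm hα hκ hpor ν hν hlamE hA hlam hε q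
  obtain ⟨n₀, hn₀⟩ := exists_nat_gt (ξ₀ ^ 2)
  have hprob : ∀ ω : Sample m α E, IsProbabilityMeasure (lam.map (randomMap φ ω)) := fun ω =>
    Measure.isProbabilityMeasure_map
      ((measurable_randomMap hφ hE hm hα).comp measurable_prodMk_left).aemeasurable
  let Y : ℕ → Sample m α E → ℝ := fun n ω =>
    (‖fourierTransform (lam.map (randomMap φ ω)) (√(n + n₀ : ℕ))‖ * (√(n + n₀ : ℕ)) ^ (t / 2))
      ^ (2 * q)
  have hYm : ∀ n, Measurable (Y n) := fun n =>
    ((measurable_fourierTransform_map_randomMap hφ hE hm hα lam _).norm.mul_const _).pow_const _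
  have hY0 : ∀ n ω, 0 ≤ Y n ω := fun n ω => by positivity
  have hYint : ∀ n, Integrable (Y n) (sampleLaw ν m α E) := fun n => by
    refine Integrable.of_bound (hYm n).aestronglyMeasurable
      (((√(n + n₀ : ℕ)) ^ (t / 2)) ^ (2 * q)) (ae_of_all _ fun ω => ?_)
    rw [Real.norm_of_nonneg (hY0 n ω)]
    have := hprob ω
    simp only [Y]
    gcongr
    exact mul_le_of_le_one_left (by positivity) (norm_fourierTransform_le_one _ _)
  have hsum : Summable fun n : ℕ => C * ((n + n₀ : ℕ) : ℝ) ^ (-((τ - t) * q / 2)) := by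
    refine Summable.mul_left C ?_
    exact (summable_nat_add_iff (f := fun n : ℕ => (n : ℝ) ^ (-((τ - t) * q / 2))) n₀).2
      (Real.summable_nat_rpow.2 (by linarith))
  have hYb : ∀ n, ∫ ω, Y n ω ∂sampleLaw ν m α E
      ≤ C * ((n + n₀ : ℕ) : ℝ) ^ (-((τ - t) * q / 2)) := fun n => by
    have hξ : ξ₀ ≤ √((n + n₀ : ℕ) : ℝ) := by
      refine Real.le_sqrt_of_sq_le (hn₀.le.trans ?_)
      push_cast
      linarith [n.cast_nonneg (α := ℝ)]
    have hN : (0 : ℝ) ≤ (n + n₀ : ℕ) := Nat.cast_nonneg _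
    set ξ : ℝ := √((n + n₀ : ℕ) : ℝ)
    have hξ0 : 0 < ξ := hξ₀.trans_le hξ
    have hNξ : ((n + n₀ : ℕ) : ℝ) = ξ ^ (2 : ℝ) := by
      rw [Real.rpow_two, Real.sq_sqrt hN]
    have hint : ∫ ω, Y n ω ∂sampleLaw ν m α E
        = (∫ ω, ‖fourierTransform (lam.map (randomMap φ ω)) ξ‖ ^ (2 * q) ∂sampleLaw ν m α E)
          * (ξ ^ (t / 2)) ^ (2 * q) := by
      rw [← integral_mul_const]
      simp only [Y, mul_pow, ξ]
    rw [hint, hNξ, ← Real.rpow_mul hξ0.le, ← Real.rpow_natCast (ξ ^ (t / 2)),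
      ← Real.rpow_mul hξ0.le]
    calc _ ≤ C * ξ ^ (-τ * q) * ξ ^ (t / 2 * (2 * q : ℕ)) := by
          gcongr
          exact hC ξ hξ
      _ = _ := by
        rw [mul_assoc, ← Real.rpow_add hξ0]
        congr 2
        push_cast
        ring
  obtain ⟨R, hR⟩ := hE.isBounded.subset_closedBall (0 : ℝ)
  filter_upwards [ae_bounded_of_summable_integral hYm hY0 hYint hsum hYb] with ω hω
  obtain ⟨K, hK⟩ := hω
  have := hprob ω
  have hq0 : 2 * q ≠ 0 := by
    rintro h
    have : q = 0 := by omega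
    rw [this] at hq
    norm_num at hq
  have hmeas : Measurable (randomMap φ ω) :=
    (measurable_randomMap hφ hE hm hα).comp measurable_prodMk_left
  set R' : ℝ := max R 0 + ∑' U : holes E, holeDelta m α (U : Set ℝ)
  have hR'0 : 0 ≤ R' := add_nonneg (le_max_right _ _) (tsum_nonneg fun U => holeDelta_nonneg m α _)
  have hae : ∀ᵐ x ∂lam.map (randomMap φ ω), |x| ≤ R' := by
    rw [ae_map_iff hmeas.aemeasurable
      (measurableSet_le continuous_abs.measurable measurable_const)]
    have : ∀ᵐ x ∂lam, x ∈ E := by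
      rw [ae_iff]; exact hlamE
    filter_upwards [this] with x hx
    refine (abs_randomMap_le hφ hE hm hα ω x).trans ?_
    have := hR hx
    rw [mem_closedBall_zero_iff, Real.norm_eq_abs] at this
    exact add_le_add (this.trans (le_max_left _ _)) le_rfl
  refine exists_decay_of_sqrt (norm_fourierTransform_le_one _) (norm_fourierTransform_neg _)
    (L := 2 * Real.pi * R') (by have := Real.pi_pos; positivity)
    (norm_fourierTransform_sub_le hae) ht (K := max 1 K) (n₀ := n₀) fun n hn => ?_
  obtain ⟨k, rfl⟩ := Nat.exists_eq_add_of_le' hn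
  by_contra! h
  have h1 := (le_max_left 1 K).trans h.le
  exact (((le_max_right 1 K).trans_lt h).trans_le (le_self_pow₀ h1 hq0)).not_ge (hK k)

end RandomImage

theorem theorem3
    -- the iterated function system, its maps being contracting diffeomorphisms
    {N : ℕ} (F : Fin N → ℝ → ℝ) (β : NNReal) (hβ0 : 0 < β) (hβ1 : β ≤ 1)
    (hF : ∀ i, RandomImage.IsHolderDiffeo β (F i))
    (hFc : ∀ i, ∃ c : NNReal, ContractingWith c (F i))
    -- its attractor, which is not an interval of positive length
    (E : Set ℝ) (hE : RandomImage.IsAttractor F E)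
    (hEI : ¬ ∃ p q : ℝ, p < q ∧ E = Set.Icc p q)
    (hdisj : ∀ i j, i ≠ j →
      Disjoint (interior (convexHull ℝ (F i '' E))) (interior (convexHull ℝ (F j '' E))))
    -- the parameters of the random map
    (m : ℕ) (hm : 1 ≤ m) (α : ℝ) (hα : α ∈ Set.Icc (0 : ℝ) 1)
    (ν : MeasureTheory.Measure (Set.Icc (0 : ℝ) 1)) [MeasureTheory.IsProbabilityMeasure ν]
    (hν : Filter.Tendsto (RandomImage.fourierTransform (ν.map Subtype.val))
      (Filter.cocompact ℝ) (nhds 0))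
    (φ : ℝ → ℝ) (hφ : RandomImage.IsStep φ)
    -- the measure
    (lam : MeasureTheory.Measure ℝ) [MeasureTheory.IsProbabilityMeasure lam]
    (hlamE : lam Eᶜ = 0)
    (A s : ℝ) (hs : 0 ≤ s)
    (hlam : ∀ p q : ℝ, p ≤ q → lam.real (Set.Icc p q) ≤ A * (q - p) ^ s) :
    ∀ᵐ ω ∂(RandomImage.sampleLaw ν m α E),
      s / (m + α) ≤ RandomImage.fourierDim (lam.map (RandomImage.randomMap φ ω)) := by
  obtain ⟨κ, hκ, hpor⟩ := RandomImage.exists_porosity hβ0 hF hFc hE hEI hdisj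
  have hA : 0 ≤ A := by
    have := MeasureTheory.measureReal_nonneg.trans (hlam 0 1 zero_le_one)
    simpa using this
  have hs1 : s ≤ 1 := RandomImage.exponent_le_one hE.isCompact hlamE hlam
  have hmα : (1 : ℝ) ≤ m + α := by
    have h1 : (1 : ℝ) ≤ m := by exact_mod_cast hm
    linarith [hα.1]
  have hle1 : s / (m + α) ≤ 1 := (div_le_one (by linarith)).2 (by linarith)
  have hall : ∀ᵐ ω ∂(RandomImage.sampleLaw ν m α E),
      ∀ t : ℚ, 0 ≤ (t : ℝ) → (t : ℝ) < s / (m + α) →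
      ∃ C : ℝ, ∀ ξ, ξ ≠ 0 →
        ‖RandomImage.fourierTransform (lam.map (RandomImage.randomMap φ ω)) ξ‖ ≤ C * |ξ| ^ (-(t : ℝ) / 2) := by
    refine MeasureTheory.ae_all_iff.2 fun t => ?_
    by_cases h : 0 ≤ (t : ℝ) ∧ (t : ℝ) < s / (m + α)
    · filter_upwards [RandomImage.ae_exists_decay hφ hE.isCompact hm hα hκ hpor ν hν hlamE hA hlam
        ⟨h.1, h.2.le.trans hle1⟩ h.2] with ω hω _ _
      exact hω
    · exact Filter.Eventually.of_forall fun ω h0 h1 => absurd ⟨h0, h1⟩ h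
  filter_upwards [hall] with ω hω
  refine le_of_forall_rat_lt_imp_le fun t ht => ?_
  rcases lt_or_ge (t : ℝ) 0 with h | h
  · exact h.le.trans (Real.sSup_nonneg fun x hx => hx.1.1)
  · exact le_csSup ⟨1, fun x hx => hx.1.2⟩ ⟨⟨h, ht.le.trans hle1⟩, hω t h ht⟩
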